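/- **Setting.** A *constraint* is a nonempty downwards-closed family $\mathcal F\subseteq 2^{[n]}$. For a product distribution $\mathcal D=D_1\times\dots\times D_n$ of finitely supported distributions on $\mathbb R$ let $\mathrm{ExPost}(\mathcal F,\mathcal D)=\mathbb E_{x\sim\mathcal D}\big[\max_{S\in\mathcal F}\sum_{i\in S}x_i\big]$. A *semi-online algorithm* for $(\mathcal F,\mathcal D)$ starts with $S=\emptyset$ and repeatedly either halts or picks $i\notin S$ with $S\cup\{i\}\in\mathcal F$ and a threshold $\tau$; it only learns whether $x_i\ge\tau$, and if so $i$ is added to $S$. Its value $\mathrm{Val}_{\mathcal F,\mathcal D}$ is the expectation of $\sum_{i\in S}x_i$ for the final set $S$. An *MC-CICS instance* $\mathbb I=(\mathcal F,\mathbb M)$ consists of a constraint $\mathcal F\subseteq 2^{[n]}$ and finite acyclic Markov chains $\mathcal M_1,\dots,\mathcal M_n$, each with a root state, a cost $c_i(s)\ge 0$ and a transition distribution at each nonterminal state $s$, and a value $v_i(t)\in\mathbb R$ at each terminal state $t$. A *policy* starts with all chains at their roots and adaptively either advances a chain $i$ in a nonterminal state $s_i$, paying $c_i(s_i)$ and observing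 the random new state, or halts by accepting a set $S\in\mathcal F$ of chains that are in terminal states, collecting $\sum_{i\in S}v_i(s_i)$. Its utility $\mathrm{Util}_{\mathbb I}$ is the expected collected value minus the expected total cost, and $\mathrm{OPT}(\mathbb I)$ is the supremum of the utilities of all policies. Algorithms are uniform interactive programs with exact unit-cost real arithmetic and comparison (a real RAM). An algorithm is *computationally efficient* if its total running time, on every possible realization, is at most a polynomial in the size of its input, where a real number has size $1$. The input consists of a description of $\mathcal F$ together with the supports and probabilities of $\mathcal D$ (for semi-online algorithms), respectively the states, costs, values and transition probabilities of $\mathbb M$ (for policies). **Theorem.** Let $(\mathcal F_k)_{k\in K}$ be a family of constraints $\mathcal F_k\subseteq 2^{[n_k]}$, presented to algorithms through any fixed encoding (a single constraint being the case $|K|=1$), and let $\alpha_k\in\mathbb R$. Let $\mathrm B$ be a computationally-efficient semi-online algorithm that $\alpha$-approximates the ex post optimum, i.e. $\mathrm{ExPost}(\mathcal F_k,\mathcal D)\le\alpha_k\,\mathrm{Val}_{\mathcal F_k,\mathcal D}(\mathrm B)$ for all $k$ and all $\mathcal D$. Then there exists a computationally-efficient policy $\mathcal T_{\mathrm B}$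 that $\alpha$-approximates the optimum on all MC-CICS instances: $\mathrm{OPT}(\mathbb I)\le\alpha_k\,\mathrm{Util}_{\mathbb I}(\mathcal T_{\mathrm B})$ for all $k$ and all $\mathbb I=(\mathcal F_k,\mathbb M)$. -/

import Mathlib

open scoped BigOperators

namespace CICS

/-! ## Model of computation

Programs over finite data structures whose atoms are real numbers, with unit-cost exact arithmetic,
comparison and pointer operations (a real random access machine presented as a structured,
uniform programming language with unbounded loops). -/

/-- Types of data handled by programs. -/
inductive Ty : Type
  | unit : Ty
  | real : Ty
  | sum : Ty → Ty → Ty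
  | prod : Ty → Ty → Ty
  | list : Ty → Ty

/-- Data of a given type. -/
@[reducible] def Ty.Val : Ty → Type
  | .unit => Unit
  | .real => ℝ
  | .sum a b => a.Val ⊕ b.Val
  | .prod a b => a.Val × b.Val
  | .list a => List a.Val

/-- Size of a datum: the number of its cells, a real number occupying one cell. -/
def Ty.size : (a : Ty) → a.Val → ℕ
  | .unit, _ => 1
  | .real, _ => 1
  | .sum a _, .inl x => a.size x + 1
  | .sum _ b, .inr y => b.size y + 1
  | .prod a b, x => a.size x.1 + b.size x.2 + 1
  | .list a, l => (l.map a.size).sum + l.length + 1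

/-- Booleans. -/
abbrev Ty.bool : Ty := .sum .unit .unit

/-- Natural numbers in unary. -/
abbrev Ty.nat : Ty := .list .unit

def encBool (b : Bool) : Ty.bool.Val := if b then .inl () else .inr ()

def encNat (m : ℕ) : Ty.nat.Val := List.replicate m ()

/-- Programs turning data of one type into data of another. The only operations on real numbers are
constants, field operations and comparison; `loop f` repeats `f` until it returns on the right. -/
inductive Prog : Ty → Ty → Type
  | id {a : Ty} : Prog a a
  | comp {a b c : Ty} (g : Prog b c) (f : Prog a b) : Prog a c
  | unit {a : Ty} : Prog a .unit
  | fst {a b : Ty} : Prog (.prod a b) a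
  | snd {a b : Ty} : Prog (.prod a b) b
  | pair {a b c : Ty} (f : Prog a b) (g : Prog a c) : Prog a (.prod b c)
  | inl {a b : Ty} : Prog a (.sum a b)
  | inr {a b : Ty} : Prog b (.sum a b)
  | case {a b c d : Ty} (f : Prog (.prod a c) d) (g : Prog (.prod b c) d) :
      Prog (.prod (.sum a b) c) d
  | nil {a b : Ty} : Prog a (.list b)
  | cons {a : Ty} : Prog (.prod a (.list a)) (.list a)
  | uncons {a : Ty} : Prog (.list a) (.sum .unit (.prod a (.list a)))
  | const {a : Ty} (r : ℝ) : Prog a .real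
  | add : Prog (.prod .real .real) .real
  | sub : Prog (.prod .real .real) .real
  | mul : Prog (.prod .real .real) .real
  | div : Prog (.prod .real .real) .real
  | le : Prog (.prod .real .real) Ty.bool
  | loop {a b : Ty} (f : Prog a (.sum a b)) : Prog a b

/-- Iteration of a step relation (with running times) until it returns on the right. -/
inductive LoopRuns {A B : Type} (step : A → A ⊕ B → ℕ → Prop) : A → B → ℕ → Prop
  | done {x : A} {y : B} {t : ℕ} : step x (.inr y) t → LoopRuns step x y (t + 1)
  | again {x z : A} {y : B} {t u : ℕ} :
      step x (.inl z) t → LoopRuns step z y u → LoopRuns step x y (t + u + 1)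

/-- `p.Runs x y t`: on input `x` the program `p` halts with output `y` after exactly `t` steps.
(Division by zero returns zero.) -/
def Prog.Runs : {a b : Ty} → Prog a b → a.Val → b.Val → ℕ → Prop
  | _, _, .id, x, y, t => y = x ∧ t = 1
  | _, _, .comp g f, x, y, t => ∃ z t₁ t₂, f.Runs x z t₁ ∧ g.Runs z y t₂ ∧ t = t₁ + t₂ + 1
  | _, _, .unit, _, y, t => y = () ∧ t = 1
  | _, _, .fst, x, y, t => y = x.1 ∧ t = 1
  | _, _, .snd, x, y, t => y = x.2 ∧ t = 1
  | _, _, .pair f g, x, y, t => ∃ t₁ t₂, f.Runs x y.1 t₁ ∧ g.Runs x y.2 t₂ ∧ t = t₁ + t₂ + 1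
  | _, _, .inl, x, y, t => y = .inl x ∧ t = 1
  | _, _, .inr, x, y, t => y = .inr x ∧ t = 1
  | _, _, .case f _, (.inl u, c), y, t => ∃ t₁, f.Runs (u, c) y t₁ ∧ t = t₁ + 1
  | _, _, .case _ g, (.inr v, c), y, t => ∃ t₁, g.Runs (v, c) y t₁ ∧ t = t₁ + 1
  | _, _, .nil, _, y, t => y = [] ∧ t = 1
  | _, _, .cons, x, y, t => y = x.1 :: x.2 ∧ t = 1
  | _, _, .uncons, [], y, t => y = .inl () ∧ t = 1
  | _, _, .uncons, h :: l, y, t => y = .inr (h, l) ∧ t = 1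
  | _, _, .const r, _, y, t => y = r ∧ t = 1
  | _, _, .add, x, y, t => y = x.1 + x.2 ∧ t = 1
  | _, _, .sub, x, y, t => y = x.1 - x.2 ∧ t = 1
  | _, _, .mul, x, y, t => y = x.1 * x.2 ∧ t = 1
  | _, _, .div, x, y, t => y = x.1 / x.2 ∧ t = 1
  | _, _, .le, x, y, t => y = encBool (decide (x.1 ≤ x.2)) ∧ t = 1
  | _, _, .loop f, x, y, t => LoopRuns f.Runs x y t

/-- An interactive algorithm: from the input it computes a memory content and a first action;
from the memory content and the observation that answers its last action it computes the next
memory content and action. -/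
structure InteractiveAlg (inp obs act : Ty) where
  mem : Ty
  start : Prog inp (.prod mem act)
  next : Prog (.prod mem obs) (.prod mem act)

/-! ## Constraints and Bayesian combinatorial selection -/

/-- A (nonempty) downwards-closed feasibility constraint on `n` alternatives. -/
structure Constraint (n : ℕ) where
  sets : Finset (Finset (Fin n))
  empty_mem : ∅ ∈ sets
  down_closed : ∀ S ∈ sets, ∀ R, R ⊆ S → R ∈ sets

/-- A finitely supported probability distribution on `ℝ`, listed by increasing atoms. -/
structure FinDist where
  card : ℕ
  val : Fin card → ℝ
  prob : Fin card → ℝ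
  val_strictMono : StrictMono val
  prob_pos : ∀ j, 0 < prob j
  prob_sum : ∑ j, prob j = 1

/-- Expectation of `f` under the product distribution `D 0 × ⋯ × D (n - 1)`. -/
noncomputable def expect {n : ℕ} (D : Fin n → FinDist) (f : (Fin n → ℝ) → ℝ) : ℝ :=
  ∑ j : (∀ i, Fin (D i).card), (∏ i, (D i).prob (j i)) * f (fun i => (D i).val (j i))

/-- `x` is a possible realization of the product distribution. -/
def InSupport {n : ℕ} (D : Fin n → FinDist) (x : Fin n → ℝ) : Prop :=
  ∀ i, x i ∈ Set.range (D i).val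

/-- The ex post optimum `E [max_{S ∈ F} ∑_{i ∈ S} x i]`. -/
noncomputable def exPost {n : ℕ} (F : Constraint n) (D : Fin n → FinDist) : ℝ :=
  expect D fun x => F.sets.sup' ⟨∅, F.empty_mem⟩ fun S => ∑ i ∈ S, x i

/-- Semi-online selection procedures (as decision trees) that have already accepted the set `S`:
either halt, or pick an element `i ∉ S` with `S ∪ {i}` feasible and a threshold `θ`, accept `i`
if its value is at least `θ`, and continue depending on this one bit of information only. -/
inductive SemiOnline {n : ℕ} (F : Constraint n) : Finset (Fin n) → Type
  | halt {S : Finset (Fin n)} : SemiOnline F S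
  | probe {S : Finset (Fin n)} (i : Fin n) (hi : i ∉ S) (hF : insert i S ∈ F.sets) (θ : ℝ)
      (yes : SemiOnline F (insert i S)) (no : SemiOnline F S) : SemiOnline F S

/-- The set finally accepted when the values are `x`. -/
noncomputable def SemiOnline.accepted {n : ℕ} {F : Constraint n} (x : Fin n → ℝ) :
    {S : Finset (Fin n)} → SemiOnline F S → Finset (Fin n)
  | S, .halt => S
  | _, .probe i _ _ θ yes no => if θ ≤ x i then yes.accepted x else no.accepted x

/-- The expected total value obtained by a semi-online procedure. -/
noncomputable def SemiOnline.value {n : ℕ} {F : Constraint n} (A : SemiOnline F ∅)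
    (D : Fin n → FinDist) : ℝ :=
  expect D fun x => ∑ i ∈ A.accepted x, x i

/-! ## Selection with costly information over Markov chains -/

/-- A finite acyclic Markov chain with action costs and terminal values. The states are
`0, …, m`, the root is `0`; `value` matters at terminal states only, `cost` and `trans` (the cost
and the transition probabilities of the unique action) at the other states only. -/
structure MarkovChain where
  m : ℕ
  terminal : Fin (m + 1) → Bool
  value : Fin (m + 1) → ℝ
  cost : Fin (m + 1) → ℝ
  trans : Fin (m + 1) → Fin (m + 1) → ℝ
  cost_nonneg : ∀ s, terminal s = false → 0 ≤ cost s
  trans_nonneg : ∀ s, terminal s = false → ∀ r, 0 ≤ trans s r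
  trans_sum : ∀ s, terminal s = false → ∑ r, trans s r = 1
  acyclic : ∀ s, ¬ Relation.TransGen (fun q r => terminal q = false ∧ 0 < trans q r) s s

abbrev MarkovChain.State (M : MarkovChain) : Type := Fin (M.m + 1)

/-- Policies (as adaptive decision trees, arbitrarily dependent on the history) from the joint
state `s`: either halt and accept a feasible set of chains in terminal states, or advance a chain
in a nonterminal state and continue depending on its new state. -/
inductive Policy {n : ℕ} (F : Constraint n) (M : Fin n → MarkovChain) :
    (∀ i, (M i).State) → Type
  | halt {s : ∀ i, (M i).State} (S : Finset (Fin n)) (hS : S ∈ F.sets)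
      (hT : ∀ i ∈ S, (M i).terminal (s i) = true) : Policy F M s
  | advance {s : ∀ i, (M i).State} (i : Fin n) (hi : (M i).terminal (s i) = false)
      (next : ∀ r : (M i).State, Policy F M (Function.update s i r)) : Policy F M s

/-- Expected utility: expected accepted value minus expected total cost. -/
noncomputable def Policy.util {n : ℕ} {F : Constraint n} {M : Fin n → MarkovChain} :
    {s : ∀ i, (M i).State} → Policy F M s → ℝ
  | s, .halt S _ _ => ∑ i ∈ S, (M i).value (s i)
  | s, .advance i _ next => -(M i).cost (s i) + ∑ r, (M i).trans (s i) r * (next r).util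

/-- The root joint state. -/
def root {n : ℕ} (M : Fin n → MarkovChain) : ∀ i, (M i).State := fun _ => 0

/-- The optimal expected utility. -/
noncomputable def opt {n : ℕ} (F : Constraint n) (M : Fin n → MarkovChain) : ℝ :=
  ⨆ π : Policy F M (root M), π.util

/-! ## Algorithms for families of constraints

A family `F k` (`k : K`) of constraints is presented to algorithms through an encoding
`enc k` of its members as data of some type `a`. -/

/-- A product distribution as data: for every element the list of (atom, probability). -/
abbrev Ty.dists : Ty := .list (.list (.prod .real .real))

def encDists {n : ℕ} (D : Fin n → FinDist) : Ty.dists.Val :=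
  List.ofFn fun i => List.ofFn fun j => ((D i).val j, (D i).prob j)

/-- A tuple of Markov chains as data: for every chain the list of its states, a terminal state
given by its value, any other state by its cost and its vector of transition probabilities. -/
abbrev Ty.chains : Ty := .list (.list (.sum .real (.prod .real (.list .real))))

def encChains {n : ℕ} (M : Fin n → MarkovChain) : Ty.chains.Val :=
  List.ofFn fun i => List.ofFn fun s =>
    if (M i).terminal s then .inl ((M i).value s)
    else .inr ((M i).cost s, List.ofFn ((M i).trans s))

/-- Semi-online algorithms: an action is to halt or to probe an element with a threshold;
the answer is whether the value is at least the threshold. -/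
abbrev SemiOnlineAlg (a : Ty) : Type :=
  InteractiveAlg (.prod a Ty.dists) Ty.bool (.sum .unit (.prod Ty.nat .real))

/-- Algorithmic policies: an action is to halt and accept a list of chains or to advance a chain;
the answer is the new state of that chain. -/
abbrev PolicyAlg (a : Ty) : Type :=
  InteractiveAlg (.prod a Ty.chains) Ty.nat (.sum (.list Ty.nat) Ty.nat)

/-- From the configuration (memory, pending action) `c`, with values `x`, the algorithm `B`
proceeds as the procedure prescribes, and halts within `t` further steps. -/
def SemiOnline.Follows {n : ℕ} {F : Constraint n} {a : Ty} (B : SemiOnlineAlg a)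
    (x : Fin n → ℝ) : {S : Finset (Fin n)} → SemiOnline F S →
      (Ty.prod B.mem (.sum .unit (.prod Ty.nat .real))).Val → ℕ → Prop
  | _, .halt, c, _ => c.2 = .inl ()
  | _, .probe i _ _ θ yes no, c, t => c.2 = .inr (encNat i, θ) ∧
      ∃ d t₁ t₂, B.next.Runs (c.1, encBool (decide (θ ≤ x i))) d t₁ ∧ t₁ + t₂ ≤ t ∧
        (θ ≤ x i → yes.Follows B x d t₂) ∧ (x i < θ → no.Follows B x d t₂)

/-- On input `(e, D)` the algorithm `B` executes the semi-online procedure `A`, its total running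
time being at most `t` for every possible realization of the values. -/
def InteractiveAlg.ExecutesSemiOnline {a : Ty} (B : SemiOnlineAlg a) {n : ℕ} {F : Constraint n}
    (e : a.Val) (D : Fin n → FinDist) (A : SemiOnline F ∅) (t : ℕ) : Prop :=
  ∃ c t₀, B.start.Runs (e, encDists D) c t₀ ∧
    ∀ x, InSupport D x → ∃ t₁, A.Follows B x c t₁ ∧ t₀ + t₁ ≤ t

/-- `B` is a polynomial-time semi-online algorithm for the family `F`. -/
def InteractiveAlg.EfficientSemiOnline {a : Ty} (B : SemiOnlineAlg a) {K : Type*} {n : K → ℕ}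
    (F : ∀ k, Constraint (n k)) (enc : K → a.Val) : Prop :=
  ∃ p : Polynomial ℕ, ∀ (k : K) (D : Fin (n k) → FinDist), ∃ A : SemiOnline (F k) ∅,
    B.ExecutesSemiOnline (enc k) D A
      (p.eval ((Ty.prod a Ty.dists).size (enc k, encDists D)))

/-- `B` approximates the ex post optimum over `F k` within the factor `α k`, for all product
distributions. (The executed procedure is unique up to branches that are never taken.) -/
def InteractiveAlg.ApproximatesExPost {a : Ty} (B : SemiOnlineAlg a) {K : Type*} {n : K → ℕ}
    (F : ∀ k, Constraint (n k)) (enc : K → a.Val) (α : K → ℝ) : Prop :=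
  ∀ (k : K) (D : Fin (n k) → FinDist), ∃ (A : SemiOnline (F k) ∅) (t : ℕ),
    B.ExecutesSemiOnline (enc k) D A t ∧ exPost (F k) D ≤ α k * A.value D

/-- From the configuration (memory, pending action) `c` the algorithm `T` proceeds as the policy
prescribes, whatever transitions of positive probability occur, and halts within `t` further
steps. -/
def Policy.Follows {n : ℕ} {F : Constraint n} {M : Fin n → MarkovChain} {a : Ty}
    (T : PolicyAlg a) : {s : ∀ i, (M i).State} → Policy F M s →
      (Ty.prod T.mem (.sum (.list Ty.nat) Ty.nat)).Val → ℕ → Prop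
  | _, .halt S _ _, c, _ => ∃ l : List (Fin n), l.toFinset = S ∧
      c.2 = .inl (l.map fun i => encNat i)
  | s, .advance i _ next, c, t => c.2 = .inr (encNat i) ∧
      ∀ r, 0 < (M i).trans (s i) r →
        ∃ d t₁ t₂, T.next.Runs (c.1, encNat r) d t₁ ∧ t₁ + t₂ ≤ t ∧ (next r).Follows T d t₂

/-- On input `(e, M)` the algorithm `T` executes the policy `π`, its total running time being at
most `t` in every possible trajectory. -/
def InteractiveAlg.ExecutesPolicy {a : Ty} (T : PolicyAlg a) {n : ℕ} {F : Constraint n}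
    (e : a.Val) (M : Fin n → MarkovChain) (π : Policy F M (root M)) (t : ℕ) : Prop :=
  ∃ c t₀ t₁, T.start.Runs (e, encChains M) c t₀ ∧ π.Follows T c t₁ ∧ t₀ + t₁ ≤ t

/-- `T` is a polynomial-time policy for the instances over Markov chains with constraint in the
family `F`. -/
def InteractiveAlg.EfficientPolicy {a : Ty} (T : PolicyAlg a) {K : Type*} {n : K → ℕ}
    (F : ∀ k, Constraint (n k)) (enc : K → a.Val) : Prop :=
  ∃ p : Polynomial ℕ, ∀ (k : K) (M : Fin (n k) → MarkovChain), ∃ π : Policy (F k) M (root M),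
    T.ExecutesPolicy (enc k) M π
      (p.eval ((Ty.prod a Ty.chains).size (enc k, encChains M)))

/-- `T` approximates the optimal utility within the factor `α k` on all instances over Markov
chains with constraint `F k`. (The executed policy is unique up to branches of probability
zero.) -/
def InteractiveAlg.ApproximatesOpt {a : Ty} (T : PolicyAlg a) {K : Type*} {n : K → ℕ}
    (F : ∀ k, Constraint (n k)) (enc : K → a.Val) (α : K → ℝ) : Prop :=
  ∀ (k : K) (M : Fin (n k) → MarkovChain), ∃ (π : Policy (F k) M (root M)) (t : ℕ),
    T.ExecutesPolicy (enc k) M π t ∧ opt (F k) M ≤ α k * π.util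

end CICS

/-! The argument replaces every chain by a single random number. Working backwards from the terminal
states, each state `s` receives an index `g(s)` and a surrogate value `W(s)`. At a terminal state
both equal the value. At a nonterminal state of cost `c`, let `X` be the surrogate value of the
random successor; then `g(s)` solves `E (X - g(s))⁺ = c`, and `W(s) = min X g(s)`. Thus `W(s)` is
the least index met on the way to a terminal state, and the cost of an advance is exactly the
expected part of `X` cut off by the cap.

For a joint state, take the surrogates of the chains to be independent. For any function `f` of
them, advancing chain `i` changes the expectation of `f` by the mean of `f(.., y, ..) - f(.., min y
g, ..)` over the successor's surrogate `y` (`expect_advance`). Two choices of `f` carry the proof.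

Upper bound: if `f` is the best feasible sum, the difference is at most `(y - g)⁺`, whose mean is
the cost. So expected `f` minus cost never increases under an advance, and no policy beats the ex
post optimum of the root surrogates (`util_le_expect`).

Lower bound: run `B` on the root surrogate distributions. When it probes `i` with threshold `θ`,
answer no if `θ` exceeds the current index, since the surrogate never does; answer yes if the chain
is terminal and `θ` is at most its value; otherwise advance the chain and look again. While `θ ≤ g`,
the answer is the same for `y` and for `min y g`, and after a yes the coordinate is never inspected
again. So the gain of the procedure changes by exactly `(y - g)⁺` (`gain_update_sub`), and the
utility of the simulation equals the value of `B` on the surrogates (`exists_policy_simulating`).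
That `B` learns a single bit per probe is essential: the surrogate itself need not be known when the
answer is given.

Efficiency: the index is a maximum of finitely many explicit quotients, hence computable by field
operations and comparisons (`atomsMean_reservation`). Surrogate laws have small support because
capping at an index creates no other new atom (`exists_atoms_entryRound`). As many rounds of
recomputation as there are states suffice by acyclicity (`entryAfter_succ_eq`). Each advance lowers
the number of states still reachable, which bounds the length of the simulation. -/

namespace CICS

/-! ## Rules for running programs -/

namespace Prog

variable {a b c d : Ty}

theorem runs_id (x : a.Val) : (Prog.id : Prog a a).Runs x x 1 := ⟨rfl, rfl⟩

theorem Runs.comp {g : Prog b c} {f : Prog a b} {x : a.Val} {z : b.Val} {y : c.Val} {t u : ℕ}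
    (hf : f.Runs x z t) (hg : g.Runs z y u) : (Prog.comp g f).Runs x y (t + u + 1) :=
  ⟨z, t, u, hf, hg, rfl⟩

theorem runs_fst (x : a.Val) (y : b.Val) : (Prog.fst : Prog (.prod a b) a).Runs (x, y) x 1 :=
  ⟨rfl, rfl⟩

theorem runs_snd (x : a.Val) (y : b.Val) : (Prog.snd : Prog (.prod a b) b).Runs (x, y) y 1 :=
  ⟨rfl, rfl⟩

theorem Runs.pair {f : Prog a b} {g : Prog a c} {x : a.Val} {y : b.Val} {z : c.Val} {t u : ℕ}
    (hf : f.Runs x y t) (hg : g.Runs x z u) : (Prog.pair f g).Runs x (y, z) (t + u + 1) :=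
  ⟨t, u, hf, hg, rfl⟩

theorem runs_inl (x : a.Val) : (Prog.inl : Prog a (.sum a b)).Runs x (.inl x) 1 := ⟨rfl, rfl⟩

theorem runs_inr (x : b.Val) : (Prog.inr : Prog b (.sum a b)).Runs x (.inr x) 1 := ⟨rfl, rfl⟩

theorem Runs.case_inl {f : Prog (.prod a c) d} {g : Prog (.prod b c) d} {x : a.Val} {z : c.Val}
    {y : d.Val} {t : ℕ} (hf : f.Runs (x, z) y t) : (Prog.case f g).Runs (.inl x, z) y (t + 1) :=
  ⟨t, hf, rfl⟩

theorem Runs.case_inr {f : Prog (.prod a c) d} {g : Prog (.prod b c) d} {x : b.Val} {z : c.Val}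
    {y : d.Val} {t : ℕ} (hg : g.Runs (x, z) y t) : (Prog.case f g).Runs (.inr x, z) y (t + 1) :=
  ⟨t, hg, rfl⟩

theorem runs_nil (x : a.Val) : (Prog.nil : Prog a (.list b)).Runs x [] 1 := ⟨rfl, rfl⟩

theorem runs_cons (x : a.Val) (l : List a.Val) :
    (Prog.cons : Prog (.prod a (.list a)) (.list a)).Runs (x, l) (x :: l) 1 := ⟨rfl, rfl⟩

theorem runs_uncons_nil : (Prog.uncons : Prog (.list a) _).Runs [] (.inl ()) 1 := ⟨rfl, rfl⟩

theorem runs_uncons_cons (x : a.Val) (l : List a.Val) :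
    (Prog.uncons : Prog (.list a) _).Runs (x :: l) (.inr (x, l)) 1 := ⟨rfl, rfl⟩

theorem Runs.loop_done {f : Prog a (.sum a b)} {x : a.Val} {y : b.Val} {t : ℕ}
    (h : f.Runs x (.inr y) t) : (Prog.loop f).Runs x y (t + 1) := LoopRuns.done h

theorem Runs.loop_again {f : Prog a (.sum a b)} {x z : a.Val} {y : b.Val} {t u : ℕ}
    (h : f.Runs x (.inl z) t) (h' : (Prog.loop f).Runs z y u) :
    (Prog.loop f).Runs x y (t + u + 1) := LoopRuns.again h h'

theorem _root_.CICS.LoopRuns.deterministic {A B : Type} {step : A → A ⊕ B → ℕ → Prop}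
    (hs : ∀ x y y' t t', step x y t → step x y' t' → y = y' ∧ t = t')
    {x : A} {y y' : B} {t t' : ℕ} (h : LoopRuns step x y t) (h' : LoopRuns step x y' t') :
    y = y' ∧ t = t' := by
  induction h generalizing y' t' with
  | done h₁ =>
    cases h' with
    | done h₂ => obtain ⟨h, rfl⟩ := hs _ _ _ _ _ h₁ h₂; exact ⟨Sum.inr.inj h, rfl⟩
    | again h₂ _ => exact absurd (hs _ _ _ _ _ h₁ h₂).1 (by simp)
  | again h₁ _ ih =>
    cases h' with
    | done h₂ => exact absurd (hs _ _ _ _ _ h₁ h₂).1 (by simp)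
    | again h₂ h₃ =>
      obtain ⟨h, rfl⟩ := hs _ _ _ _ _ h₁ h₂
      obtain rfl := Sum.inl.inj h
      obtain ⟨rfl, rfl⟩ := ih h₃
      exact ⟨rfl, rfl⟩

/-- Executions of `B` are described separately for each vector of values. Determinism is what
identifies the executions for two vectors that have produced the same answers. -/
theorem Runs.deterministic {p : Prog a b} {x : a.Val} {y y' : b.Val} {t t' : ℕ}
    (h : p.Runs x y t) (h' : p.Runs x y' t') : y = y' ∧ t = t' := by
  induction p generalizing t t' with
  | comp g f ihg ihf =>
    obtain ⟨z, t₁, t₂, h₁, h₂, rfl⟩ := h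
    obtain ⟨z', t₁', t₂', h₁', h₂', rfl⟩ := h'
    obtain ⟨rfl, rfl⟩ := ihf h₁ h₁'
    obtain ⟨rfl, rfl⟩ := ihg h₂ h₂'
    exact ⟨rfl, rfl⟩
  | pair f g ihf ihg =>
    obtain ⟨t₁, t₂, h₁, h₂, rfl⟩ := h
    obtain ⟨t₁', t₂', h₁', h₂', rfl⟩ := h'
    obtain ⟨e₁, rfl⟩ := ihf h₁ h₁'
    obtain ⟨e₂, rfl⟩ := ihg h₂ h₂'
    exact ⟨Prod.ext e₁ e₂, rfl⟩
  | case f g ihf ihg =>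
    obtain ⟨u | v, c⟩ := x
    · obtain ⟨t₁, h, rfl⟩ := h
      obtain ⟨t₁', h', rfl⟩ := h'
      obtain ⟨rfl, rfl⟩ := ihf h h'
      exact ⟨rfl, rfl⟩
    · obtain ⟨t₁, h, rfl⟩ := h
      obtain ⟨t₁', h', rfl⟩ := h'
      obtain ⟨rfl, rfl⟩ := ihg h h'
      exact ⟨rfl, rfl⟩
  | uncons =>
    cases x with
    | nil => exact ⟨h.1.trans h'.1.symm, h.2.trans h'.2.symm⟩
    | cons _ _ => exact ⟨h.1.trans h'.1.symm, h.2.trans h'.2.symm⟩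
  | loop f ih => exact LoopRuns.deterministic (step := f.Runs) (fun _ _ _ _ _ h h' => ih h h') h h'
  | _ => exact ⟨h.1.trans h'.1.symm, h.2.trans h'.2.symm⟩

/-- Since every call of `B.next` takes at least one step, the overhead of simulating the call can be
charged to the running time of `B`. -/
theorem Runs.pos {p : Prog a b} {x : a.Val} {y : b.Val} {t : ℕ} (h : p.Runs x y t) : 0 < t := by
  cases p with
  | comp g f => obtain ⟨_, _, _, _, _, rfl⟩ := h; omega
  | pair f g => obtain ⟨_, _, _, _, rfl⟩ := h; omega
  | case f g =>
    obtain ⟨u | v, c⟩ := x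
    · obtain ⟨_, _, rfl⟩ := h; omega
    · obtain ⟨_, _, rfl⟩ := h; omega
  | uncons =>
    cases x with
    | nil => exact h.2 ▸ one_pos
    | cons _ _ => exact h.2 ▸ one_pos
  | loop f => cases (show LoopRuns _ _ _ _ from h) <;> omega
  | _ => exact h.2 ▸ one_pos

end Prog

/-! ## Functions computable in polynomial time -/

theorem eval_mono (q : Polynomial ℕ) {m n : ℕ} (h : m ≤ n) : q.eval m ≤ q.eval n := by
  induction q using Polynomial.induction_on' with
  | add p q hp hq => simpa using add_le_add hp hq
  | monomial k r => simpa using Nat.mul_le_mul_left r (Nat.pow_le_pow_left h k)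

/-- `f` is computed by a program in polynomial time, with values of polynomial size. -/
def Poly {a b : Ty} (f : a.Val → b.Val) : Prop :=
  ∃ (p : Prog a b) (q : Polynomial ℕ), ∀ x, b.size (f x) ≤ q.eval (a.size x) ∧
    ∃ t ≤ q.eval (a.size x), p.Runs x (f x) t

namespace Poly

variable {a b c d e : Ty}

theorem id : Poly (fun x : a.Val => x) :=
  ⟨.id, .X + 1, fun x => ⟨by simp, 1, by simp, Prog.runs_id x⟩⟩

/-- The size bound in `Poly` is needed here and does not follow from the time bound: `pair id id`
takes constant time but more than doubles the size of its input, so iterated pairing could grow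
exponentially. -/
theorem comp {g : b.Val → c.Val} {f : a.Val → b.Val} (hg : Poly g) (hf : Poly f) :
    Poly (fun x => g (f x)) := by
  obtain ⟨p, q, hp⟩ := hg
  obtain ⟨p', q', hp'⟩ := hf
  refine ⟨.comp p p', q.comp q' + q' + 1, fun x => ?_⟩
  obtain ⟨h₁, t₁, ht₁, hr₁⟩ := hp' x
  obtain ⟨h₂, t₂, ht₂, hr₂⟩ := hp (f x)
  have := eval_mono q h₁
  simp only [Polynomial.eval_add, Polynomial.eval_comp, Polynomial.eval_one]
  exact ⟨by omega, _, by omega, hr₁.comp hr₂⟩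

theorem pair {f : a.Val → b.Val} {g : a.Val → c.Val} (hf : Poly f) (hg : Poly g) :
    Poly (b := .prod b c) (fun x => (f x, g x)) := by
  obtain ⟨p, q, hp⟩ := hf
  obtain ⟨p', q', hp'⟩ := hg
  refine ⟨.pair p p', q + q' + 1, fun x => ?_⟩
  obtain ⟨h₁, t₁, ht₁, hr₁⟩ := hp x
  obtain ⟨h₂, t₂, ht₂, hr₂⟩ := hp' x
  simp only [Polynomial.eval_add, Polynomial.eval_one, Ty.size]
  exact ⟨by omega, _, by omega, hr₁.pair hr₂⟩

theorem fst {f : a.Val → (Ty.prod b c).Val} (hf : Poly f) : Poly (fun x => (f x).1) :=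
  comp (g := Prod.fst) ⟨.fst, .X + 1, fun x => by
    simp only [Polynomial.eval_add, Polynomial.eval_one, Polynomial.eval_X, Ty.size]
    exact ⟨by omega, 1, by omega, rfl, rfl⟩⟩ hf

theorem snd {f : a.Val → (Ty.prod b c).Val} (hf : Poly f) : Poly (fun x => (f x).2) :=
  comp (g := Prod.snd) ⟨.snd, .X + 1, fun x => by
    simp only [Polynomial.eval_add, Polynomial.eval_one, Polynomial.eval_X, Ty.size]
    exact ⟨by omega, 1, by omega, rfl, rfl⟩⟩ hf

theorem inl {f : a.Val → b.Val} (hf : Poly f) : Poly (b := .sum b c) (fun x => .inl (f x)) :=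
  comp (g := Sum.inl) ⟨.inl, .X + 1, fun x => by
    simp only [Polynomial.eval_add, Polynomial.eval_one, Polynomial.eval_X, Ty.size]
    exact ⟨by omega, 1, by omega, rfl, rfl⟩⟩ hf

theorem inr {f : a.Val → c.Val} (hf : Poly f) : Poly (b := .sum b c) (fun x => .inr (f x)) :=
  comp (g := Sum.inr) ⟨.inr, .X + 1, fun x => by
    simp only [Polynomial.eval_add, Polynomial.eval_one, Polynomial.eval_X, Ty.size]
    exact ⟨by omega, 1, by omega, rfl, rfl⟩⟩ hf

theorem unit : Poly (b := .unit) (fun _ : a.Val => ()) :=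
  ⟨.unit, 1, fun x => ⟨by simp [Ty.size], 1, by simp, rfl, rfl⟩⟩

theorem const (r : ℝ) : Poly (b := .real) (fun _ : a.Val => r) :=
  ⟨.const r, 1, fun x => ⟨by simp [Ty.size], 1, by simp, rfl, rfl⟩⟩

theorem nil : Poly (b := .list b) (fun _ : a.Val => []) :=
  ⟨.nil, 1, fun x => ⟨by simp [Ty.size], 1, by simp, rfl, rfl⟩⟩

theorem cons {f : a.Val → b.Val} {g : a.Val → List b.Val} (hf : Poly f)
    (hg : Poly (b := .list b) g) : Poly (b := .list b) (fun x => f x :: g x) :=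
  comp (b := .prod b (.list b)) (g := fun x => x.1 :: x.2) ⟨.cons, .X + 1, fun x => by
    simp only [Polynomial.eval_add, Polynomial.eval_one, Polynomial.eval_X, Ty.size,
      List.map_cons, List.sum_cons, List.length_cons]
    exact ⟨by omega, 1, by omega, rfl, rfl⟩⟩ (hf.pair hg)

theorem real_op {g : ℝ × ℝ → ℝ} (p : Prog (.prod .real .real) .real)
    (hp : ∀ x, p.Runs x (g x) 1) {f₁ f₂ : a.Val → ℝ} (h₁ : Poly (b := .real) f₁)
    (h₂ : Poly (b := .real) f₂) : Poly (b := .real) (fun x => g (f₁ x, f₂ x)) :=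
  comp (b := .prod .real .real) (g := g) ⟨p, 1, fun x => ⟨by simp [Ty.size], 1, by simp, hp x⟩⟩
    (h₁.pair h₂)

theorem add {f g : a.Val → ℝ} (hf : Poly (b := .real) f) (hg : Poly (b := .real) g) :
    Poly (b := .real) (fun x => f x + g x) :=
  real_op (g := fun x => x.1 + x.2) .add (fun _ => ⟨rfl, rfl⟩) hf hg

theorem sub {f g : a.Val → ℝ} (hf : Poly (b := .real) f) (hg : Poly (b := .real) g) :
    Poly (b := .real) (fun x => f x - g x) :=
  real_op (g := fun x => x.1 - x.2) .sub (fun _ => ⟨rfl, rfl⟩) hf hg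

theorem mul {f g : a.Val → ℝ} (hf : Poly (b := .real) f) (hg : Poly (b := .real) g) :
    Poly (b := .real) (fun x => f x * g x) :=
  real_op (g := fun x => x.1 * x.2) .mul (fun _ => ⟨rfl, rfl⟩) hf hg

theorem div {f g : a.Val → ℝ} (hf : Poly (b := .real) f) (hg : Poly (b := .real) g) :
    Poly (b := .real) (fun x => f x / g x) :=
  real_op (g := fun x => x.1 / x.2) .div (fun _ => ⟨rfl, rfl⟩) hf hg

/-- Case distinction on a value of a sum type. -/
theorem sumElim {s : a.Val → b.Val ⊕ c.Val} {f : b.Val × a.Val → d.Val} {g : c.Val × a.Val → d.Val}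
    (hs : Poly (b := .sum b c) s) (hf : Poly (a := .prod b a) f) (hg : Poly (a := .prod c a) g) :
    Poly (fun x => Sum.elim (fun u => f (u, x)) (fun v => g (v, x)) (s x)) := by
  refine comp (b := .prod (.sum b c) a)
    (g := fun z => Sum.elim (fun u => f (u, z.2)) (fun v => g (v, z.2)) z.1) ?_ (hs.pair id)
  obtain ⟨p, q, hp⟩ := hf
  obtain ⟨p', q', hp'⟩ := hg
  refine ⟨.case p p', q + q' + 1, ?_⟩
  simp only [Polynomial.eval_add, Polynomial.eval_one]
  rintro ⟨u | v, x⟩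
  · obtain ⟨h₁, t₁, ht₁, hr₁⟩ := hp (u, x)
    have := eval_mono q (show (Ty.prod b a).size (u, x) ≤ (Ty.prod (.sum b c) a).size (.inl u, x) by
      simp only [Ty.size]; omega)
    exact ⟨by simp only [Sum.elim_inl]; omega, t₁ + 1, by omega, hr₁.case_inl⟩
  · obtain ⟨h₁, t₁, ht₁, hr₁⟩ := hp' (v, x)
    have := eval_mono q' (show (Ty.prod c a).size (v, x) ≤ (Ty.prod (.sum b c) a).size (.inr v, x) by
      simp only [Ty.size]; omega)
    exact ⟨by simp only [Sum.elim_inr]; omega, t₁ + 1, by omega, hr₁.case_inr⟩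

theorem decide_le {f g : a.Val → ℝ} (hf : Poly (b := .real) f) (hg : Poly (b := .real) g) :
    Poly (b := .bool) (fun x => encBool (decide (f x ≤ g x))) :=
  comp (b := .prod .real .real) (c := .bool) (g := fun x => encBool (decide (x.1 ≤ x.2)))
    ⟨.le, 2, fun x => ⟨by simp only [encBool]; split_ifs <;> simp [Ty.size], 1, by simp, rfl, rfl⟩⟩
    (hf.pair hg)

theorem ite_bool {s : a.Val → Bool} {f g : a.Val → b.Val}
    (hs : Poly (b := .bool) fun x => encBool (s x)) (hf : Poly f) (hg : Poly g) :
    Poly (fun x => if s x then f x else g x) := by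
  have := sumElim hs (hf.comp (snd id)) (hg.comp (snd id))
  convert this using 2 with x
  cases h : s x <;> simp [encBool]

theorem ite_le {f g : a.Val → ℝ} {u v : a.Val → b.Val} (hf : Poly (b := .real) f)
    (hg : Poly (b := .real) g) (hu : Poly u) (hv : Poly v) :
    Poly (fun x => if f x ≤ g x then u x else v x) := by
  simpa using ite_bool (decide_le hf hg) hu hv

/-- Case distinction on a list. -/
theorem listCases {l : a.Val → List b.Val} {f : a.Val → c.Val} {g : a.Val × b.Val × List b.Val → c.Val}
    (hl : Poly (b := .list b) l) (hf : Poly f) (hg : Poly (a := .prod a (.prod b (.list b))) g) :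
    Poly (fun x => match l x with | [] => f x | h :: t => g (x, h, t)) := by
  have hu : Poly (a := .list b) (b := .sum .unit (.prod b (.list b)))
      (fun l => match l with | [] => .inl () | h :: t => .inr (h, t)) :=
    ⟨.uncons, .X + 2, fun x => by
      cases x with
      | nil => exact ⟨by simp [Ty.size], 1, by simp, Prog.runs_uncons_nil⟩
      | cons h t =>
        refine ⟨?_, 1, by simp, Prog.runs_uncons_cons h t⟩
        simp only [Polynomial.eval_add, Polynomial.eval_X, Polynomial.eval_ofNat, Ty.size,
          List.map_cons, List.sum_cons, List.length_cons]
        omega⟩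
  have := sumElim (d := c) (hu.comp hl) (hf.comp (snd id)) (hg.comp (pair (snd id) (fst id)))
  convert this using 2 with x
  cases l x <;> rfl

end Poly

/-! ## Polynomial-time list processing -/

theorem Ty.size_list (a : Ty) (l : List a.Val) :
    (Ty.list a).size l = (l.map a.size).sum + l.length + 1 := rfl

theorem Ty.size_mem_le {a : Ty} {l : List a.Val} {x : a.Val} (h : x ∈ l) :
    a.size x + 2 ≤ (Ty.list a).size l := by
  have h₁ := List.single_le_sum (l := l.map a.size) (by simp) _ (List.mem_map_of_mem h)
  have h₂ := List.length_pos_of_mem h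
  rw [Ty.size_list]
  omega

theorem Ty.length_lt_size {a : Ty} (l : List a.Val) : l.length < (Ty.list a).size l := by
  rw [Ty.size_list]; omega

theorem Ty.size_sublist_le {a : Ty} {l l' : List a.Val} (h : l'.Sublist l) :
    (Ty.list a).size l' ≤ (Ty.list a).size l := by
  have h₁ := (h.map a.size).sum_le_sum (by simp)
  have h₂ := h.length_le
  simp only [Ty.size_list]
  omega

theorem Ty.size_list_le {a : Ty} {l : List a.Val} {B : ℕ} (h : ∀ x ∈ l, a.size x ≤ B) :
    (Ty.list a).size l ≤ l.length * (B + 1) + 1 := by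
  have := List.sum_le_card_nsmul (l.map a.size) B (by simpa using h)
  rw [Ty.size_list]
  simp only [List.length_map, smul_eq_mul] at this
  linarith [mul_add l.length B 1]

theorem Ty.size_append {a : Ty} (l l' : List a.Val) :
    (Ty.list a).size (l ++ l') + 1 = (Ty.list a).size l + (Ty.list a).size l' := by
  simp only [Ty.size_list, List.map_append, List.sum_append, List.length_append]; omega

namespace Poly

variable {a b c d : Ty}

/-- The program iterating `p` over a list, with access to the context. -/
def foldProg (p : Prog (.prod a (.prod c b)) c) (p₀ : Prog a c) (pl : Prog a (.list b)) : Prog a c :=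
  .comp (.loop (.comp (.case (.comp .inr (.comp .fst (.comp .snd .snd)))
    (.comp .inl (.pair (.comp .fst .snd) (.pair
      (.comp p (.pair (.comp .fst .snd) (.pair (.comp .fst (.comp .snd .snd)) (.comp .fst .fst))))
      (.comp .snd .fst)))))
    (.pair (.comp .uncons (.comp .snd .snd)) .id))) (.pair .id (.pair p₀ pl))

open Prog in
/-- Folding over a list is polynomial as soon as the intermediate results have polynomial size. -/
theorem foldl {l : a.Val → List b.Val} {s : a.Val → c.Val} {f : a.Val × c.Val × b.Val → c.Val}
    (hf : Poly (a := .prod a (.prod c b)) f) (hs : Poly s) (hl : Poly (b := .list b) l)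
    (hb : ∃ q : Polynomial ℕ, ∀ x l', l' <+: l x →
      c.size (l'.foldl (fun u h => f (x, u, h)) (s x)) ≤ q.eval (a.size x)) :
    Poly (fun x => (l x).foldl (fun u h => f (x, u, h)) (s x)) := by
  obtain ⟨p, q, hp⟩ := hf
  obtain ⟨p₀, q₀, hp₀⟩ := hs
  obtain ⟨pl, ql, hpl⟩ := hl
  obtain ⟨r, hr⟩ := hb
  -- A round applies `p` to a context of size `X`, an accumulator of size at most `r` and an element
  -- of size at most `ql`. Moving data around costs at most 40 more, and there are at most `ql + 1`
  -- rounds.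
  refine ⟨foldProg p p₀ pl,
    r + q₀ + ql + (ql + 1) * (q.comp (.X + r + ql + 2) + 40) + 40, fun x => ?_⟩
  simp only [Polynomial.eval_add, Polynomial.eval_mul, Polynomial.eval_comp, Polynomial.eval_X,
    Polynomial.eval_ofNat, Polynomial.eval_one]
  obtain ⟨-, t₀, ht₀, hr₀⟩ := hp₀ x
  obtain ⟨hsl, tl, htl, hrl⟩ := hpl x
  refine ⟨(hr x _ List.prefix_rfl).trans (by omega), ?_⟩
  set N := q.eval (a.size x + r.eval (a.size x) + ql.eval (a.size x) + 2) with hN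
  -- Loop invariant: the state holds the context, the fold over the processed prefix `l₁`, and the
  -- remaining suffix `l₂`.
  have key : ∀ (l₂ l₁ : List b.Val), l₁ ++ l₂ = l x →
      ∃ t ≤ (l₂.length + 1) * (N + 40),
        (Prog.loop (.comp (.case (.comp .inr (.comp .fst (.comp .snd .snd)))
          (.comp .inl (.pair (.comp .fst .snd) (.pair
            (.comp p (.pair (.comp .fst .snd)
              (.pair (.comp .fst (.comp .snd .snd)) (.comp .fst .fst))))
            (.comp .snd .fst)))))
          (.pair (.comp .uncons (.comp .snd .snd)) .id))).Runs
          (a := .prod a (.prod c (.list b)))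
          (x, l₁.foldl (fun u h => f (x, u, h)) (s x), l₂)
          ((l x).foldl (fun u h => f (x, u, h)) (s x)) t := by
    intro l₂
    induction l₂ with
    | nil =>
      intro l₁ h
      rw [List.append_nil] at h
      subst h
      refine ⟨_, ?_, Runs.loop_done (Runs.comp (Runs.pair (Runs.comp
        (Runs.comp (runs_snd _ _) (runs_snd _ _)) runs_uncons_nil) (runs_id _))
        (Runs.case_inl (Runs.comp (Runs.comp (Runs.comp (runs_snd _ _) (runs_snd _ _))
          (runs_fst _ _)) (runs_inr _))))⟩
      simp only [List.length_nil]
      omega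
    | cons h t ih =>
      intro l₁ hl
      obtain ⟨t₂, ht₂, hr₂⟩ := ih (l₁ ++ [h]) (by simpa using hl)
      rw [List.foldl_append] at hr₂
      obtain ⟨-, t₁, ht₁, hr₁⟩ := hp (x, l₁.foldl (fun u h => f (x, u, h)) (s x), h)
      have h₁ := hr x l₁ ⟨_, hl⟩
      have h₂ := Ty.size_mem_le (a := b) (x := h) (l := l x) (by simp [← hl])
      have h₃ := eval_mono q (show (Ty.prod a (.prod c b)).size
        (x, l₁.foldl (fun u h => f (x, u, h)) (s x), h) ≤
        a.size x + r.eval (a.size x) + ql.eval (a.size x) + 2 by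
          simp only [Ty.size] at h₂ hsl ⊢; omega)
      refine ⟨_, ?_, Runs.loop_again (Runs.comp (Runs.pair (Runs.comp
        (Runs.comp (runs_snd _ _) (runs_snd _ _)) (runs_uncons_cons _ _)) (runs_id _))
        (Runs.case_inr (Runs.comp (Runs.pair (Runs.comp (runs_snd _ _) (runs_fst _ _))
          (Runs.pair (Runs.comp (Runs.pair (Runs.comp (runs_snd _ _) (runs_fst _ _))
            (Runs.pair (Runs.comp (Runs.comp (runs_snd _ _) (runs_snd _ _)) (runs_fst _ _))
              (Runs.comp (runs_fst _ _) (runs_fst _ _)))) hr₁)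
            (Runs.comp (runs_fst _ _) (runs_snd _ _)))) (runs_inl _)))) hr₂⟩
      simp only [List.length_cons]
      rw [add_mul (t.length + 1)]
      omega
  obtain ⟨t, ht, hrun⟩ := key (l x) [] rfl
  refine ⟨_, ?_, Runs.comp (Runs.pair (runs_id _) (Runs.pair hr₀ hrl)) hrun⟩
  have h₁ : ((l x).length + 1) * (N + 40) ≤ (ql.eval (a.size x) + 1) * (N + 40) :=
    Nat.mul_le_mul_right _ (by have := Ty.length_lt_size (a := b) (l x); omega)
  omega

theorem reverse {l : a.Val → List b.Val} (hl : Poly (b := .list b) l) :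
    Poly (b := .list b) (fun x => (l x).reverse) := by
  refine comp (b := .list b) (c := .list b) (g := List.reverse) ?_ hl
  have := foldl (a := .list b) (c := .list b) (f := fun z => z.2.2 :: z.2.1) (l := fun l => l)
    (cons (snd (snd id)) (fst (snd id))) nil id ⟨.X, fun x l' h => by
      have := Ty.size_sublist_le (a := b) (h.sublist)
      simpa [Ty.size_list] using this⟩
  simpa using this

/-- A left fold over the reversed list. The intermediate results are now the folds over suffixes,
hence the form of the size hypothesis. -/
theorem foldr {l : a.Val → List b.Val} {s : a.Val → c.Val} {f : a.Val × b.Val × c.Val → c.Val}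
    (hf : Poly (a := .prod a (.prod b c)) f) (hs : Poly s) (hl : Poly (b := .list b) l)
    (hb : ∃ q : Polynomial ℕ, ∀ x l', l' <:+ l x →
      c.size (l'.foldr (fun h u => f (x, h, u)) (s x)) ≤ q.eval (a.size x)) :
    Poly (fun x => (l x).foldr (fun h u => f (x, h, u)) (s x)) := by
  have := foldl (f := fun z => f (z.1, z.2.2, z.2.1)) (s := s)
    (hf.comp (pair (fst id) (pair (snd (snd id)) (fst (snd id))))) hs (reverse hl) (by
      obtain ⟨q, hq⟩ := hb
      refine ⟨q, fun x l' h => ?_⟩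
      have := hq x l'.reverse (by simpa using List.reverse_suffix.2 h)
      simpa using this)
  simpa using this

theorem map {l : a.Val → List b.Val} {f : a.Val × b.Val → c.Val}
    (hf : Poly (a := .prod a b) f) (hl : Poly (b := .list b) l) :
    Poly (b := .list c) (fun x => (l x).map fun h => f (x, h)) := by
  have := foldr (c := .list c) (f := fun z => f (z.1, z.2.1) :: z.2.2) (s := fun _ => [])
    (cons (hf.comp (pair (fst id) (fst (snd id)))) (snd (snd id))) nil hl (by
      obtain ⟨p, q, hp⟩ := hf
      obtain ⟨pl, ql, hpl⟩ := hl
      refine ⟨ql * (q.comp (.X + ql + 1) + 1) + 1, fun x l' h => ?_⟩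
      have h₁ : l'.foldr (fun h u => f (x, h) :: u) [] = l'.map fun h => f (x, h) := by
        induction l' with
        | nil => rfl
        | cons y t ih => simp [ih ((List.suffix_cons _ _).trans h)]
      have h₂ := (hpl x).1
      have h₃ := (Ty.size_sublist_le (a := b) h.sublist)
      have h₄ := Ty.length_lt_size (a := b) l'
      simp only [Polynomial.eval_add, Polynomial.eval_mul, Polynomial.eval_comp, Polynomial.eval_X,
        Polynomial.eval_one]
      rw [h₁]
      refine (Ty.size_list_le (a := c) (l := l'.map fun h => f (x, h))
        (B := q.eval (a.size x + ql.eval (a.size x) + 1)) ?_).trans ?_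
      · simp only [List.mem_map, forall_exists_index, and_imp, forall_apply_eq_imp_iff₂]
        intro y hy
        refine (hp _).1.trans (eval_mono q ?_)
        have := Ty.size_mem_le hy
        simp only [Ty.size] at this h₂ h₃ ⊢
        omega
      · rw [List.length_map]
        gcongr
        omega)
  convert this using 2 with x
  induction l x with
  | nil => rfl
  | cons y t ih => simp only [List.map_cons, List.foldr_cons, ih]

theorem append {l l' : a.Val → List b.Val} (hl : Poly (b := .list b) l)
    (hl' : Poly (b := .list b) l') : Poly (b := .list b) (fun x => l x ++ l' x) := by
  have := foldr (c := .list b) (f := fun z => z.2.1 :: z.2.2) (s := l')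
    (cons (fst (snd id)) (snd (snd id))) hl' hl (by
      obtain ⟨p, q, hp⟩ := hl
      obtain ⟨p', q', hp'⟩ := hl'
      refine ⟨q + q', fun x m h => ?_⟩
      have h₁ := Ty.size_sublist_le (a := b) h.sublist
      have h₂ := Ty.size_append (a := b) m (l' x)
      have h₃ := (hp x).1
      have h₄ := (hp' x).1
      have h₅ : m.foldr (fun h u => h :: u) (l' x) = m ++ l' x := by simp
      rw [h₅, Polynomial.eval_add]
      omega)
  simpa using this

theorem filter {l : a.Val → List b.Val} {f : a.Val × b.Val → Bool}
    (hf : Poly (a := .prod a b) (b := .bool) fun z => encBool (f z))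
    (hl : Poly (b := .list b) l) :
    Poly (b := .list b) (fun x => (l x).filter fun h => f (x, h)) := by
  have key : ∀ x (l' : List b.Val), l'.foldr
      (fun h u => if f (x, h) then h :: u else u) [] = l'.filter fun h => f (x, h) := by
    intro x l'
    induction l' with
    | nil => rfl
    | cons y t ih => simp [ih, List.filter_cons]
  have := foldr (c := .list b) (s := fun _ => [])
    (f := fun z => if f (z.1, z.2.1) then z.2.1 :: z.2.2 else z.2.2)
    (ite_bool (hf.comp (pair (fst id) (fst (snd id)))) (cons (fst (snd id)) (snd (snd id)))
      (snd (snd id))) nil hl (by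
      obtain ⟨p, q, hp⟩ := hl
      refine ⟨q, fun x m h => ?_⟩
      rw [key]
      exact (Ty.size_sublist_le (List.filter_sublist.trans h.sublist)).trans (hp x).1)
  simpa only [key] using this

theorem flatten {l : a.Val → List (List b.Val)} (hl : Poly (b := .list (.list b)) l) :
    Poly (b := .list b) (fun x => (l x).flatten) := by
  have key : ∀ l' : List (List b.Val), l'.foldr (fun h u => h ++ u) [] = l'.flatten := by
    intro l'
    induction l' with
    | nil => rfl
    | cons y t ih => rw [List.foldr_cons, ih, List.flatten_cons]
  have := foldr (c := .list b) (s := fun _ => []) (f := fun z => z.2.1 ++ z.2.2)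
    (append (fst (snd id)) (snd (snd id))) nil hl (by
      obtain ⟨p, q, hp⟩ := hl
      refine ⟨q, fun x m h => ?_⟩
      rw [key]
      refine le_trans ?_ ((Ty.size_sublist_le h.sublist).trans (hp x).1)
      clear h
      induction m with
      | nil => simp [Ty.size]
      | cons y t ih =>
        have := Ty.size_append (a := b) y t.flatten
        simp only [List.flatten_cons]
        simp only [Ty.size, List.map_cons, List.sum_cons, List.length_cons] at *
        omega)
  simpa only [key] using this

theorem sum {l : a.Val → List ℝ} (hl : Poly (b := .list .real) l) :
    Poly (b := .real) (fun x => (l x).sum) := by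
  have := foldr (c := .real) (b := .real) (s := fun _ => (0 : ℝ)) (f := fun z => z.2.1 + z.2.2)
    (add (fst (snd id)) (snd (snd id))) (const 0) hl ⟨1, fun _ _ _ => by simp [Ty.size]⟩
  exact this

theorem tail {l : a.Val → List b.Val} (hl : Poly (b := .list b) l) :
    Poly (b := .list b) (fun x => (l x).tail) := by
  have := listCases (c := .list b) hl nil (snd (snd id))
  convert this using 2 with x
  cases l x <;> rfl

theorem headD {l : a.Val → List b.Val} {y : a.Val → b.Val} (hl : Poly (b := .list b) l)
    (hy : Poly y) : Poly (fun x => (l x).headD (y x)) := by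
  have := listCases (c := b) hl hy (fst (snd id))
  convert this using 2 with x
  cases l x <;> rfl

/-- Numbers are unary, so an index is itself a list and can drive a fold that takes one `tail` per
cell. -/
theorem drop {i : a.Val → List Unit} {l : a.Val → List b.Val} (hi : Poly (b := .nat) i)
    (hl : Poly (b := .list b) l) : Poly (b := .list b) (fun x => (l x).drop (i x).length) := by
  have key : ∀ (i : List Unit) (l : List b.Val), i.foldl (fun u _ => u.tail) l = l.drop i.length := by
    intro i
    induction i with
    | nil => simp
    | cons y t ih => intro l; simp [ih]
  have := foldl (b := .unit) (c := .list b) (s := l) (l := i) (f := fun z => z.2.1.tail)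
    (tail (fst (snd id))) hl hi (by
      obtain ⟨p, q, hp⟩ := hl
      refine ⟨q, fun x m h => ?_⟩
      rw [key]
      exact (Ty.size_sublist_le (List.drop_sublist _ _)).trans (hp x).1)
  simpa only [key] using this

theorem getD {i : a.Val → List Unit} {l : a.Val → List b.Val} {y : a.Val → b.Val}
    (hi : Poly (b := .nat) i) (hl : Poly (b := .list b) l) (hy : Poly y) :
    Poly (fun x => (l x).getD (i x).length (y x)) := by
  have := headD (drop hi hl) hy
  convert this using 2 with x
  simp [List.headD_eq_head?_getD, List.getD_eq_getElem?_getD]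

theorem zip {l : a.Val → List b.Val} {l' : a.Val → List c.Val} (hl : Poly (b := .list b) l)
    (hl' : Poly (b := .list c) l') :
    Poly (b := .list (.prod b c)) (fun x => (l x).zip (l' x)) := by
  -- The fold runs over the first list; its accumulator carries what is left of the second list and
  -- the output in reverse order.
  set f : List c.Val × List (b.Val × c.Val) → b.Val → List c.Val × List (b.Val × c.Val) :=
    fun u h => match u.1 with | [] => ([], u.2) | y :: t => (t, (h, y) :: u.2) with hfd
  have key : ∀ (l : List b.Val) (l' : List c.Val) (m : List (b.Val × c.Val)),
      l.foldl f (l', m) = (l'.drop l.length, (l.zip l').reverse ++ m) := by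
    intro l
    induction l with
    | nil => simp
    | cons h t ih =>
      intro l' m
      cases l' with
      | nil =>
        have : f ([], m) h = ([], m) := rfl
        simp [List.foldl_cons, this, ih]
      | cons y t' =>
        have : f (y :: t', m) h = (t', (h, y) :: m) := rfl
        simp [List.foldl_cons, this, ih]
  have hf : Poly (a := .prod a (.prod (.prod (.list c) (.list (.prod b c))) b))
      (b := .prod (.list c) (.list (.prod b c))) (fun z => f z.2.1 z.2.2) :=
    listCases (a := .prod a (.prod (.prod (.list c) (.list (.prod b c))) b)) (b := c)
      (c := .prod (.list c) (.list (.prod b c))) (l := fun z : a.Val × (List c.Val × List (b.Val × c.Val)) × b.Val => z.2.1.1)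
      (f := fun z => ([], z.2.1.2))
      (g := fun w => (w.2.2, (w.1.2.2, w.2.1) :: w.1.2.1.2))
      (fst (fst (snd id))) (pair nil (snd (fst (snd id))))
      (pair (snd (snd id)) (cons (pair (snd (snd (fst id))) (fst (snd id)))
        (snd (fst (snd (fst id))))))
  have := foldl (c := .prod (.list c) (.list (.prod b c)))
    (s := fun x => (l' x, [])) (f := fun z => f z.2.1 z.2.2) hf (pair hl' nil) hl (by
      obtain ⟨p, q, hp⟩ := hl
      obtain ⟨p', q', hp'⟩ := hl'
      refine ⟨q' + q * (q + q' + 2) + 2, fun x m h => ?_⟩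
      have h₁ := (hp x).1
      have h₂ := (hp' x).1
      have h₃ := Ty.size_sublist_le (a := c) (List.drop_sublist m.length (l' x))
      have h₄ := Ty.size_sublist_le (a := b) h.sublist
      have h₅ := Ty.length_lt_size (a := b) m
      simp only [key, Polynomial.eval_add, Polynomial.eval_mul, Polynomial.eval_ofNat,
        List.append_nil]
      have h₆ := Ty.size_list_le (a := .prod b c) (l := (m.zip (l' x)).reverse)
        (B := q.eval (a.size x) + q'.eval (a.size x) + 1) (by
          rintro ⟨u, v⟩ huv
          rw [List.mem_reverse] at huv
          have h₇ := Ty.size_mem_le (a := b) (List.of_mem_zip huv).1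
          have h₈ := Ty.size_mem_le (a := c) (List.of_mem_zip huv).2
          simp only [Ty.size] at *
          omega)
      have h₇ : (m.zip (l' x)).reverse.length ≤ m.length := by simp
      have h₈ := Nat.mul_le_mul_right (q.eval (a.size x) + q'.eval (a.size x) + 1 + 1)
        (h₇.trans (h₅.le.trans (h₄.trans h₁)))
      rw [show (Ty.prod (.list c) (.list (.prod b c))).size
        ((l' x).drop m.length, (m.zip (l' x)).reverse) =
        (Ty.list c).size ((l' x).drop m.length) +
        (Ty.list (.prod b c)).size (m.zip (l' x)).reverse + 1 from rfl]
      linarith)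
  simpa only [key, List.append_nil, List.reverse_reverse] using reverse (snd this)

/-- The prefix before position `i` is obtained by zipping with the unary index and forgetting the
units; the rest is `drop` with its head replaced, or empty if the index is out of range. -/
theorem set {i : a.Val → List Unit} {l : a.Val → List b.Val} {y : a.Val → b.Val}
    (hi : Poly (b := .nat) i) (hl : Poly (b := .list b) l) (hy : Poly y) :
    Poly (b := .list b) (fun x => (l x).set (i x).length (y x)) := by
  have hz : Poly (b := .list (.prod .unit b)) (fun x => (i x).zip (l x)) := zip hi hl
  have hm : Poly (b := .list b) (fun x => ((i x).zip (l x)).map fun z => z.2) :=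
    map (b := .prod .unit b) (f := fun w => w.2.2) (snd (snd id)) hz
  have := append hm (listCases (c := .list b) (drop hi hl) nil
    (cons (hy.comp (fst id)) (snd (snd id))))
  convert this using 2 with x
  change (l x).set _ (y x) = _ ++ (match (l x).drop (i x).length with
    | [] => [] | _ :: t => y x :: t)
  generalize i x = i, l x = l, y x = y
  induction i generalizing l with
  | nil => cases l <;> rfl
  | cons _ t ih =>
    cases l with
    | nil => simp
    | cons h l' => simpa using ih l'

end Poly

/-! ## Finite distributions as lists of weighted atoms -/

/-- Add a weighted atom to a sorted list of weighted atoms. -/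
noncomputable def insertAtom (a : ℝ × ℝ) (l : List (ℝ × ℝ)) : List (ℝ × ℝ) :=
  if a.2 ≤ 0 then l else
    l.filter (fun b => !decide (a.1 ≤ b.1)) ++
      (a.1, a.2 + ((l.filter fun b => decide (a.1 ≤ b.1) && decide (b.1 ≤ a.1)).map Prod.snd).sum) ::
        l.filter (fun b => !decide (b.1 ≤ a.1))

/-- Sort weighted atoms, merge equal atoms and drop those of nonpositive weight. -/
noncomputable def normalize (l : List (ℝ × ℝ)) : List (ℝ × ℝ) :=
  l.foldr insertAtom []

/-- The number `y` such that `∑ p * (v - y) = c`, the sum ranging over the atoms `(v, p)` of `X`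
with `v` at least the atom of `a`. -/
noncomputable def candidate (c : ℝ) (X : List (ℝ × ℝ)) (a : ℝ × ℝ) : ℝ :=
  (((X.filter fun b => decide (a.1 ≤ b.1)).map fun b => b.2 * b.1).sum - c) /
    ((X.filter fun b => decide (a.1 ≤ b.1)).map Prod.snd).sum

/-- The solution `y` of `E (X - y)⁺ = c`. -/
noncomputable def reservation (c : ℝ) : List (ℝ × ℝ) → ℝ
  | [] => 0
  | h :: t => t.foldl (fun u a => max u (candidate c (h :: t) a)) (candidate c (h :: t) h)

/-- The distribution of `min X g`, not normalized. -/
noncomputable def capAll (g : ℝ) (X : List (ℝ × ℝ)) : List (ℝ × ℝ) :=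
  X.map fun a => (min a.1 g, a.2)

/-- The entry of a state in the table of indices: its index, whether it is terminal, and the
distribution of the least index met on the way to a terminal state. -/
abbrev Ty.entry : Ty := .prod (.prod .real .bool) (.list (.prod .real .real))

/-- A state of a Markov chain as data. -/
abbrev Ty.state : Ty := .sum .real (.prod .real (.list .real))

/-- The mixture with weights `ps` of the distributions in the table `T`, not normalized. -/
noncomputable def mix (ps : List ℝ) (T : List Ty.entry.Val) : List (ℝ × ℝ) :=
  ((ps.zip T).map fun z =>
    if z.1 ≤ 0 then [] else z.2.2.map fun a => (a.1, z.1 * a.2)).flatten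

/-- The entry of a nonterminal state of cost `c` if `X` is the mixture of the distributions of its
successors. -/
noncomputable def nonterminalEntry (c : ℝ) (X : List (ℝ × ℝ)) : Ty.entry.Val :=
  ((reservation c X, .inr ()), normalize (capAll (reservation c X) X))

/-- The entry of a state computed from the entries of its successors. -/
noncomputable def entryStep (T : List Ty.entry.Val) (d : Ty.state.Val) : Ty.entry.Val :=
  Sum.elim (fun v => ((v, .inl ()), [(v, 1)]))
    (fun z => nonterminalEntry z.1 (normalize (mix z.2 T))) d

/-- Recompute all entries. -/
noncomputable def entryRound (D : List Ty.state.Val) (T : List Ty.entry.Val) :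
    List Ty.entry.Val := D.map (entryStep T)

/-- The table of indices of a Markov chain. -/
noncomputable def entryTable (D : List Ty.state.Val) : List Ty.entry.Val :=
  D.foldl (fun T _ => entryRound D T) []

/-! ### Structure of the lists -/

/-- Strict order serves twice: it is what `FinDist` demands, and it makes the atoms distinct, so
that the length of a list is bounded by the number of possible atoms. -/
abbrev AtomsSorted (l : List (ℝ × ℝ)) : Prop := l.Pairwise fun a b => a.1 < b.1

theorem insertAtom_sorted (a : ℝ × ℝ) {l : List (ℝ × ℝ)} (h : AtomsSorted l) :
    AtomsSorted (insertAtom a l) := by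
  unfold insertAtom
  split_ifs
  · exact h
  · simp only [AtomsSorted, List.pairwise_append, List.pairwise_cons]
    refine ⟨h.filter _, ⟨fun b hb => ?_, h.filter _⟩, ?_⟩
    · simpa using (List.mem_filter.1 hb).2
    · intro b hb b' hb'
      have h₁ : b.1 < a.1 := by simpa using (List.mem_filter.1 hb).2
      rcases List.mem_cons.1 hb' with rfl | hb'
      · exact h₁
      · exact h₁.trans (by simpa using (List.mem_filter.1 hb').2)

theorem normalize_sorted (l : List (ℝ × ℝ)) : AtomsSorted (normalize l) := by
  induction l with
  | nil => exact List.Pairwise.nil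
  | cons a l ih => exact insertAtom_sorted a ih

theorem length_insertAtom_le (a : ℝ × ℝ) (l : List (ℝ × ℝ)) :
    (insertAtom a l).length ≤ l.length + 1 := by
  unfold insertAtom
  split_ifs
  · omega
  -- The two filters select the atoms strictly below and strictly above `a`, hence disjoint parts of
  -- the list.
  · have : (l.filter fun b => !decide (a.1 ≤ b.1)).length +
        (l.filter fun b => !decide (b.1 ≤ a.1)).length ≤ l.length := by
      induction l with
      | nil => simp
      | cons b l ih =>
        simp only [List.filter_cons]
        rcases le_total a.1 b.1 with h | h
        · simp only [h, decide_true, Bool.not_true, Bool.false_eq_true, if_false]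
          split_ifs <;> simp only [List.length_cons] <;> omega
        · simp only [h, decide_true, Bool.not_true, Bool.false_eq_true, if_false]
          split_ifs <;> simp only [List.length_cons] <;> omega
    simp only [List.length_append, List.length_cons]
    omega

theorem length_normalize_le (l : List (ℝ × ℝ)) : (normalize l).length ≤ l.length := by
  induction l with
  | nil => simp [normalize]
  | cons a l ih =>
    have := length_insertAtom_le a (normalize l)
    simp only [normalize, List.foldr_cons, List.length_cons] at *
    omega

theorem fst_of_mem_insertAtom {a b : ℝ × ℝ} {l : List (ℝ × ℝ)} (h : b ∈ insertAtom a l) :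
    b.1 = a.1 ∨ b ∈ l := by
  unfold insertAtom at h
  split_ifs at h
  · exact .inr h
  · rcases List.mem_append.1 h with h | h
    · exact .inr (List.mem_filter.1 h).1
    · rcases List.mem_cons.1 h with rfl | h
      · exact .inl rfl
      · exact .inr (List.mem_filter.1 h).1

theorem fst_of_mem_normalize {b : ℝ × ℝ} {l : List (ℝ × ℝ)} (h : b ∈ normalize l) :
    ∃ a ∈ l, b.1 = a.1 := by
  induction l with
  | nil => simp [normalize] at h
  | cons a l ih =>
    rcases fst_of_mem_insertAtom h with h | h
    · exact ⟨a, by simp, h⟩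
    · obtain ⟨a', h₁, h₂⟩ := ih h
      exact ⟨a', List.mem_cons_of_mem _ h₁, h₂⟩

theorem mem_mix {a : ℝ × ℝ} {ps : List ℝ} {T : List Ty.entry.Val} (h : a ∈ mix ps T) :
    ∃ e ∈ T, ∃ b ∈ e.2, a.1 = b.1 := by
  simp only [mix, List.mem_flatten, List.mem_map] at h
  obtain ⟨_, ⟨⟨p, e⟩, hz, rfl⟩, ha⟩ := h
  split_ifs at ha
  · simp at ha
  · obtain ⟨b, hb, rfl⟩ := List.mem_map.1 ha
    exact ⟨e, (List.of_mem_zip hz).2, b, hb, rfl⟩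

theorem entryStep_sorted (T : List Ty.entry.Val) (d : Ty.state.Val) :
    AtomsSorted (entryStep T d).2 := by
  rcases d with v | ⟨c, ps⟩
  · simp [entryStep]
  · exact normalize_sorted _

/-- A minimum of two numbers is one of them, so capping keeps an old atom or produces the index
itself. -/
theorem fst_of_mem_entryStep {T : List Ty.entry.Val} {d : Ty.state.Val} {a : ℝ × ℝ}
    (h : a ∈ (entryStep T d).2) :
    a.1 = (entryStep T d).1.1 ∨ ∃ e ∈ T, ∃ b ∈ e.2, a.1 = b.1 := by
  rcases d with v | ⟨c, ps⟩
  · left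
    simp only [entryStep, Sum.elim_inl, List.mem_singleton] at h ⊢
    rw [h]
  · obtain ⟨a', h₁, h₂⟩ := fst_of_mem_normalize h
    obtain ⟨b, hb, rfl⟩ := List.mem_map.1 h₁
    rcases min_choice b.1 (reservation c (normalize (mix ps T))) with h | h
    · right
      obtain ⟨b', h₃, h₄⟩ := fst_of_mem_normalize hb
      obtain ⟨e, he, b'', h₅, h₆⟩ := mem_mix h₃
      exact ⟨e, he, b'', h₅, by rw [h₂, ← h₆, ← h₄]; exact h⟩
    · left
      rw [h₂]
      exact h

/-- Without merging, the lists could grow exponentially with the number of rounds. With merging, all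
atoms are indices computed so far, and a round contributes at most one new index per state. -/
theorem exists_atoms_entryRound (D : List Ty.state.Val) (k : ℕ) :
    ∃ U : Finset ℝ, U.card ≤ k * D.length ∧
      ∀ e ∈ (entryRound D)^[k] [], AtomsSorted e.2 ∧ ∀ a ∈ e.2, a.1 ∈ U := by
  induction k with
  | zero => exact ⟨∅, by simp⟩
  | succ k ih =>
    obtain ⟨U, hU, hT⟩ := ih
    rw [Function.iterate_succ_apply']
    set T := (entryRound D)^[k] []
    refine ⟨U ∪ (D.map fun d => (entryStep T d).1.1).toFinset, ?_, fun e he => ?_⟩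
    · have h₁ := Finset.card_union_le U (D.map fun d => (entryStep T d).1.1).toFinset
      have h₂ := List.toFinset_card_le (D.map fun d => (entryStep T d).1.1)
      rw [List.length_map] at h₂
      linarith
    · obtain ⟨d, hd, rfl⟩ := List.mem_map.1 he
      refine ⟨entryStep_sorted T d, fun a ha => ?_⟩
      rw [Finset.mem_union]
      rcases fst_of_mem_entryStep ha with h | ⟨e, he, b, hb, h⟩
      · exact .inr (List.mem_toFinset.2 (List.mem_map.2 ⟨d, hd, h.symm⟩))
      · exact .inl (h ▸ (hT e he).2 b hb)

theorem AtomsSorted.length_le {l : List (ℝ × ℝ)} (h : AtomsSorted l) {U : Finset ℝ}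
    (hU : ∀ a ∈ l, a.1 ∈ U) : l.length ≤ U.card := by
  have hn : (l.map Prod.fst).Nodup := by
    rw [List.Nodup, List.pairwise_map]
    exact h.imp fun h => h.ne
  rw [← List.length_map (f := Prod.fst), ← List.toFinset_card_of_nodup hn]
  exact Finset.card_le_card fun x hx => by
    obtain ⟨a, ha, rfl⟩ := List.mem_map.1 (List.mem_toFinset.1 hx)
    exact hU a ha

theorem foldl_const_eq_iterate {α β : Type*} (g : α → α) (l : List β) (s : α) :
    l.foldl (fun u _ => g u) s = g^[l.length] s := by
  induction l generalizing s with
  | nil => rfl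
  | cons _ l ih => exact ih _

theorem entryTable_eq (D : List Ty.state.Val) :
    entryTable D = (entryRound D)^[D.length] [] := foldl_const_eq_iterate _ _ _

/-! ### Running times -/

theorem size_atoms (l : List (ℝ × ℝ)) :
    (Ty.list (.prod .real .real)).size l = 4 * l.length + 1 := by
  induction l with
  | nil => simp [Ty.size]
  | cons a l ih =>
    simp only [Ty.size, List.map_cons, List.sum_cons, List.length_cons] at *
    omega

theorem size_bool (b : Ty.bool.Val) : Ty.bool.size b = 2 := by
  rcases b with b | b <;> rfl

namespace Poly

variable {a b : Ty}

theorem bnot {s : a.Val → Bool} (hs : Poly (b := .bool) fun x => encBool (s x)) :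
    Poly (b := .bool) fun x => encBool (!s x) := by
  have := ite_bool (b := .bool) hs (inr unit) (inl unit)
  convert this using 2 with x
  cases s x <;> rfl

theorem band {s s' : a.Val → Bool} (hs : Poly (b := .bool) fun x => encBool (s x))
    (hs' : Poly (b := .bool) fun x => encBool (s' x)) :
    Poly (b := .bool) fun x => encBool (s x && s' x) := by
  have := ite_bool (b := .bool) hs hs' (inr unit)
  convert this using 2 with x
  cases s x <;> rfl

theorem max {f g : a.Val → ℝ} (hf : Poly (b := .real) f) (hg : Poly (b := .real) g) :
    Poly (b := .real) fun x => max (f x) (g x) := by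
  simp only [max_def]
  exact ite_le hf hg hg hf

theorem min {f g : a.Val → ℝ} (hf : Poly (b := .real) f) (hg : Poly (b := .real) g) :
    Poly (b := .real) fun x => min (f x) (g x) := by
  simp only [min_def]
  exact ite_le hf hg hf hg

end Poly

abbrev Ty.atom : Ty := .prod .real .real

theorem poly_insertAtom : Poly (a := .prod .atom (.list .atom)) (b := .list .atom)
    (fun z => insertAtom z.1 z.2) := by
  have hv : Poly (a := .prod (.prod .atom (.list .atom)) .atom) (b := .real)
    (fun w => w.1.1.1) := .fst (.fst (.fst .id))
  have hb : Poly (a := .prod (.prod .atom (.list .atom)) .atom) (b := .real)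
    (fun w => w.2.1) := .fst (.snd .id)
  have hl : Poly (a := .prod .atom (.list .atom)) (b := .list .atom) (fun z => z.2) := .snd .id
  have h₁ := Poly.filter (a := .prod .atom (.list .atom)) (b := .atom)
    (f := fun w => !decide (w.1.1.1 ≤ w.2.1)) (.bnot (.decide_le hv hb)) hl
  have h₂ := Poly.filter (a := .prod .atom (.list .atom)) (b := .atom)
    (f := fun w => !decide (w.2.1 ≤ w.1.1.1)) (.bnot (.decide_le hb hv)) hl
  have h₃ := Poly.filter (a := .prod .atom (.list .atom)) (b := .atom)
    (f := fun w => decide (w.1.1.1 ≤ w.2.1) && decide (w.2.1 ≤ w.1.1.1))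
    (.band (.decide_le hv hb) (.decide_le hb hv)) hl
  have h₄ := Poly.sum (Poly.map (a := .prod .atom (.list .atom)) (b := .atom) (c := .real)
    (f := fun w => w.2.2) (.snd (.snd .id)) h₃)
  have hp : Poly (a := .prod .atom (.list .atom)) (b := .real) (fun z => z.1.2) := .snd (.fst .id)
  have hw : Poly (a := .prod .atom (.list .atom)) (b := .real) (fun z => z.1.1) := .fst (.fst .id)
  exact .ite_le hp (.const 0) hl (.append h₁ (.cons (.pair hw (.add hp h₄)) h₂))

theorem poly_normalize : Poly (a := .list .atom) (b := .list .atom) normalize := by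
  refine Poly.foldr (a := .list .atom) (b := .atom) (c := .list .atom) (l := fun l => l) (s := fun _ => [])
    (f := fun z => insertAtom z.2.1 z.2.2) (poly_insertAtom.comp (.snd .id)) .nil .id
    ⟨.X, fun x l' h => ?_⟩
  have h₁ := length_normalize_le l'
  have h₂ := h.length_le
  rw [Polynomial.eval_X, size_atoms, size_atoms]
  simp only [normalize] at h₁
  change 4 * (l'.foldr insertAtom []).length + 1 ≤ _
  omega

theorem poly_candidate : Poly (a := .prod (.prod .real (.list .atom)) .atom) (b := .real)
    (fun z => candidate z.1.1 z.1.2 z.2) := by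
  have hf := Poly.filter (a := .prod (.prod .real (.list .atom)) .atom) (b := .atom)
    (l := fun z => z.1.2) (f := fun w => decide (w.1.2.1 ≤ w.2.1))
    (.decide_le (.fst (.snd (.fst .id))) (.fst (.snd .id))) (.snd (.fst .id))
  have h₁ := Poly.sum (Poly.map (a := .prod (.prod .real (.list .atom)) .atom) (b := .atom)
    (c := .real) (f := fun w => w.2.2 * w.2.1)
    (.mul (.snd (.snd .id)) (.fst (.snd .id))) hf)
  have h₂ := Poly.sum (Poly.map (a := .prod (.prod .real (.list .atom)) .atom) (b := .atom)
    (c := .real) (f := fun w => w.2.2) (.snd (.snd .id)) hf)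
  exact .div (.sub h₁ (.fst (.fst .id))) h₂

theorem poly_reservation : Poly (a := .prod .real (.list .atom)) (b := .real)
    (fun z => reservation z.1 z.2) := by
  have hf : Poly (a := .prod (.prod (.prod .real (.list .atom)) (.prod .atom (.list .atom)))
      (.prod .real .atom)) (b := .real)
      (fun w => Max.max w.2.1 (candidate w.1.1.1 w.1.1.2 w.2.2)) :=
    .max (.fst (.snd .id)) (poly_candidate.comp
      (a := .prod (.prod (.prod .real (.list .atom)) (.prod .atom (.list .atom)))
        (.prod .real .atom)) (f := fun w => (w.1.1, w.2.2))
      (.pair (.fst (.fst .id)) (.snd (.snd .id))))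
  have hfold := Poly.foldl (a := .prod (.prod .real (.list .atom)) (.prod .atom (.list .atom)))
    (b := .atom) (c := .real) (l := fun w => w.2.2)
    (s := fun w => candidate w.1.1 w.1.2 w.2.1) hf
    (poly_candidate.comp (a := .prod (.prod .real (.list .atom)) (.prod .atom (.list .atom))) (f := fun w => (w.1, w.2.1)) (.pair (.fst .id) (.fst (.snd .id))))
    (.snd (.snd .id)) ⟨1, fun _ _ _ => by simp [Ty.size]⟩
  have := Poly.listCases (a := .prod .real (.list .atom)) (b := .atom) (c := .real)
    (l := fun z => z.2) (.snd .id) (.const 0) hfold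
  convert this using 2 with z
  obtain ⟨c, _ | ⟨h, t⟩⟩ := z <;> rfl

theorem poly_capAll : Poly (a := .prod .real (.list .atom)) (b := .list .atom)
    (fun z => capAll z.1 z.2) :=
  .map (a := .prod .real (.list .atom)) (b := .atom) (c := .atom) (l := fun z => z.2)
    (f := fun w => (Min.min w.2.1 w.1.1, w.2.2))
    (.pair (.min (.fst (.snd .id)) (.fst (.fst .id))) (.snd (.snd .id))) (.snd .id)

theorem poly_mix : Poly (a := .prod (.list .real) (.list .entry)) (b := .list .atom)
    (fun z => mix z.1 z.2) := by
  have hz := Poly.zip (a := .prod (.list .real) (.list .entry)) (b := .real) (c := .entry)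
    (l := fun z => z.1) (l' := fun z => z.2) (.fst .id) (.snd .id)
  have hs : Poly (a := .prod (.prod (.list .real) (.list .entry)) (.prod .real .entry))
      (b := .list .atom) (fun w => w.2.2.2.map fun a => (a.1, w.2.1 * a.2)) :=
    .map (a := .prod (.prod (.list .real) (.list .entry)) (.prod .real .entry))
      (b := .atom) (c := .atom) (l := fun w => w.2.2.2) (f := fun u => (u.2.1, u.1.2.1 * u.2.2))
      (.pair (.fst (.snd .id)) (.mul (.fst (.snd (.fst .id))) (.snd (.snd .id))))
      (.snd (.snd (.snd .id)))
  have hi : Poly (a := .prod (.prod (.list .real) (.list .entry)) (.prod .real .entry))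
      (b := .list .atom)
      (fun w => if w.2.1 ≤ 0 then [] else w.2.2.2.map fun a => (a.1, w.2.1 * a.2)) :=
    .ite_le (.fst (.snd .id)) (.const 0) .nil hs
  exact .flatten (.map hi hz)

theorem poly_nonterminalEntry : Poly (a := .prod .real (.list .atom)) (b := .entry)
    (fun z => nonterminalEntry z.1 z.2) :=
  .pair (.pair poly_reservation (.inr .unit))
    (poly_normalize.comp (poly_capAll.comp (a := .prod .real (.list .atom)) (f := fun z => (reservation z.1 z.2, z.2))
      (.pair poly_reservation (.snd .id))))

theorem poly_entryStep : Poly (a := .prod (.list .entry) .state) (b := .entry)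
    (fun z => entryStep z.1 z.2) := by
  have hm : Poly (a := .prod (.prod .real (.list .real)) (.prod (.list .entry) .state))
      (b := .list .atom) (fun w => mix w.1.2 w.2.1) :=
    poly_mix.comp (a := .prod (.prod .real (.list .real)) (.prod (.list .entry) .state))
      (f := fun w => (w.1.2, w.2.1)) (.pair (.snd (.fst .id)) (.fst (.snd .id)))
  have hn : Poly (a := .prod (.prod .real (.list .real)) (.prod (.list .entry) .state))
      (b := .entry) (fun w => nonterminalEntry w.1.1 (normalize (mix w.1.2 w.2.1))) := by
    have hX := poly_normalize.comp hm
    have hp := Poly.pair (a := .prod (.prod .real (.list .real)) (.prod (.list .entry) .state))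
      (.fst (.fst .id)) hX
    have := poly_nonterminalEntry.comp hp
    exact this
  have ht : Poly (a := .prod .real (.prod (.list .entry) .state)) (b := .entry)
      (fun w => ((w.1, .inl ()), [(w.1, 1)])) :=
    .pair (.pair (.fst .id) (.inl .unit)) (.cons (.pair (.fst .id) (.const 1)) .nil)
  exact .sumElim (s := fun z : List Ty.entry.Val × Ty.state.Val => z.2) (.snd .id) ht hn

theorem poly_entryTable : Poly (a := .list .state) (b := .list .entry) entryTable := by
  have hr : Poly (a := .prod (.list .state) (.prod (.list .entry) .state)) (b := .list .entry)
      (fun z => entryRound z.1 z.2.1) := by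
    have hp := Poly.pair (a := .prod (.prod (.list .state) (.prod (.list .entry) .state)) .state)
      (.fst (.snd (.fst .id))) (.snd .id)
    have hs := poly_entryStep.comp hp
    exact .map hs (.fst .id)
  -- For input size `N` the table has at most `N` entries. An entry has at most `N * N` atoms of
  -- four cells each and six further cells; the seventh is its list cell, and the final 1 ends the
  -- table.
  refine Poly.foldl (a := .list .state) (b := .state) (c := .list .entry)
    (l := fun D => D) (s := fun _ => []) hr .nil .id
    ⟨.X * (4 * (.X * .X) + 7) + 1, fun D l' h => ?_⟩
  simp only [foldl_const_eq_iterate (entryRound D)]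
  obtain ⟨U, hU, hT⟩ := exists_atoms_entryRound D l'.length
  have h₁ := Ty.length_lt_size (a := .state) D
  have h₂ := h.length_le
  simp only [Polynomial.eval_add, Polynomial.eval_mul, Polynomial.eval_X, Polynomial.eval_ofNat,
    Polynomial.eval_one]
  have h₃ : ((entryRound D)^[l'.length] []).length ≤ D.length := by
    cases l'.length with
    | zero => simp
    | succ k => simp [Function.iterate_succ_apply', entryRound]
  set N := (Ty.list .state).size D
  have h₄ : l'.length * D.length ≤ N * N := Nat.mul_le_mul (by omega) (by omega)
  refine (Ty.size_list_le (a := .entry) (B := 4 * (N * N) + 6) fun e he => ?_).trans ?_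
  · have h₅ := (hT e he).1.length_le (hT e he).2
    rw [show Ty.entry.size e = 1 + Ty.bool.size e.1.2 + 1 +
      (Ty.list (.prod .real .real)).size e.2 + 1 from rfl, size_atoms, size_bool]
    omega
  · exact Nat.add_le_add_right (Nat.mul_le_mul (by omega) le_rfl) 1

/-! ## Expectations -/

/-- The sum of `f` over weighted atoms. -/
def atomsMean (l : List (ℝ × ℝ)) (f : ℝ → ℝ) : ℝ := (l.map fun a => a.2 * f a.1).sum

@[simp] theorem atomsMean_nil (f : ℝ → ℝ) : atomsMean [] f = 0 := rfl

@[simp] theorem atomsMean_cons (a : ℝ × ℝ) (l : List (ℝ × ℝ)) (f : ℝ → ℝ) :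
    atomsMean (a :: l) f = a.2 * f a.1 + atomsMean l f := rfl

@[simp] theorem atomsMean_append (l l' : List (ℝ × ℝ)) (f : ℝ → ℝ) :
    atomsMean (l ++ l') f = atomsMean l f + atomsMean l' f := by
  simp [atomsMean]

theorem atomsMean_trichotomy (v : ℝ) (l : List (ℝ × ℝ)) (f : ℝ → ℝ) :
    atomsMean l f = atomsMean (l.filter fun b => !decide (v ≤ b.1)) f +
      ((l.filter fun b => decide (v ≤ b.1) && decide (b.1 ≤ v)).map Prod.snd).sum * f v +
      atomsMean (l.filter fun b => !decide (b.1 ≤ v)) f := by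
  induction l with
  | nil => simp
  | cons b l ih =>
    rw [atomsMean_cons, ih]
    rcases lt_trichotomy v b.1 with h | h | h
    · simp [h.le, h.not_ge]; ring
    · simp [h]; ring
    · simp [h.le, h.not_ge]; ring

/-- Insertion drops atoms of nonpositive weight; for nonnegative weights only those of weight zero
are lost, and they do not contribute. -/
theorem atomsMean_insertAtom {a : ℝ × ℝ} (ha : 0 ≤ a.2) (l : List (ℝ × ℝ)) (f : ℝ → ℝ) :
    atomsMean (insertAtom a l) f = a.2 * f a.1 + atomsMean l f := by
  unfold insertAtom
  split_ifs with h
  · simp [le_antisymm h ha]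
  · rw [atomsMean_append, atomsMean_cons, atomsMean_trichotomy a.1 l f]
    ring

theorem atomsMean_normalize {l : List (ℝ × ℝ)} (hl : ∀ a ∈ l, 0 ≤ a.2) (f : ℝ → ℝ) :
    atomsMean (normalize l) f = atomsMean l f := by
  induction l with
  | nil => rfl
  | cons a l ih =>
    rw [atomsMean_cons, ← ih fun b hb => hl b (List.mem_cons_of_mem _ hb)]
    exact atomsMean_insertAtom (hl a List.mem_cons_self) _ f

theorem insertAtom_pos {a : ℝ × ℝ} {l : List (ℝ × ℝ)} (hl : ∀ b ∈ l, 0 < b.2) :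
    ∀ b ∈ insertAtom a l, 0 < b.2 := by
  unfold insertAtom
  split_ifs with h
  · exact hl
  · intro b hb
    rcases List.mem_append.1 hb with hb | hb
    · exact hl b (List.mem_filter.1 hb).1
    · rcases List.mem_cons.1 hb with rfl | hb
      · have : 0 ≤ ((l.filter fun b => decide (a.1 ≤ b.1) && decide (b.1 ≤ a.1)).map
            Prod.snd).sum := List.sum_nonneg fun x hx => by
          obtain ⟨b, hb, rfl⟩ := List.mem_map.1 hx
          exact (hl b (List.mem_filter.1 hb).1).le
        exact add_pos_of_pos_of_nonneg (not_le.1 h) this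
      · exact hl b (List.mem_filter.1 hb).1

theorem normalize_pos (l : List (ℝ × ℝ)) : ∀ b ∈ normalize l, 0 < b.2 := by
  induction l with
  | nil => simp [normalize]
  | cons a l ih => exact insertAtom_pos ih

theorem atomsMean_capAll (g : ℝ) (X : List (ℝ × ℝ)) (f : ℝ → ℝ) :
    atomsMean (capAll g X) f = atomsMean X fun y => f (min y g) := by
  simp [atomsMean, capAll, Function.comp_def]

theorem atomsMean_mix {m : ℕ} {p : Fin m → ℝ} (hp : ∀ r, 0 ≤ p r) (T : Fin m → Ty.entry.Val)
    (f : ℝ → ℝ) :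
    atomsMean (mix (List.ofFn p) (List.ofFn T)) f = ∑ r, p r * atomsMean (T r).2 f := by
  induction m with
  | zero => simp [mix]
  | succ m ih =>
    rw [Fin.sum_univ_succ, ← ih (fun r => hp r.succ) fun r => T r.succ]
    simp only [mix, List.ofFn_succ, List.zip_cons_cons, List.map_cons, List.flatten_cons,
      atomsMean_append]
    congr 1
    split_ifs with h
    · simp [le_antisymm h (hp 0)]
    · simp only [atomsMean, List.map_map, Function.comp_def, ← List.sum_map_mul_left, mul_assoc]

theorem mix_nonneg {ps : List ℝ} {T : List Ty.entry.Val} (hT : ∀ e ∈ T, ∀ a ∈ e.2, 0 ≤ a.2) :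
    ∀ a ∈ mix ps T, 0 ≤ a.2 := by
  intro a h
  simp only [mix, List.mem_flatten, List.mem_map] at h
  obtain ⟨_, ⟨⟨p, e⟩, hz, rfl⟩, ha⟩ := h
  split_ifs at ha with h
  · simp at ha
  · obtain ⟨b, hb, rfl⟩ := List.mem_map.1 ha
    exact mul_nonneg (not_le.1 h).le (hT e (List.of_mem_zip hz).2 b hb)

/-- Entries weighted by zero may be wrong without harm. This matters because acyclicity restricts
transitions of positive probability only. -/
theorem mix_congr {m : ℕ} {p : Fin m → ℝ} {T T' : Fin m → Ty.entry.Val}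
    (h : ∀ r, 0 < p r → T r = T' r) :
    mix (List.ofFn p) (List.ofFn T) = mix (List.ofFn p) (List.ofFn T') := by
  induction m with
  | zero => simp
  | succ m ih =>
    simp only [mix, List.ofFn_succ, List.zip_cons_cons, List.map_cons, List.flatten_cons]
    congr 1
    · split_ifs with h'
      · rfl
      · rw [h 0 (not_le.1 h')]
    · exact ih fun r => h r.succ

/-! ### The reservation value -/

theorem foldl_max_spec {β : Type*} (k : β → ℝ) (t : List β) (u : ℝ) :
    (u ≤ t.foldl (fun u a => max u (k a)) u ∧ ∀ a ∈ t, k a ≤ t.foldl (fun u a => max u (k a)) u) ∧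
      (t.foldl (fun u a => max u (k a)) u = u ∨
        ∃ a ∈ t, t.foldl (fun u a => max u (k a)) u = k a) := by
  induction t generalizing u with
  | nil => simp
  | cons b t ih =>
    obtain ⟨⟨h₁, h₂⟩, h₃⟩ := ih (max u (k b))
    simp only [List.foldl_cons]
    refine ⟨⟨(le_max_left _ _).trans h₁, fun a ha => ?_⟩, ?_⟩
    · rcases List.mem_cons.1 ha with rfl | ha
      · exact (le_max_right _ _).trans h₁
      · exact h₂ a ha
    · rcases h₃ with h₃ | ⟨a, ha, h₃⟩
      · rcases max_choice u (k b) with h | h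
        · exact .inl (h₃.trans h)
        · exact .inr ⟨b, by simp, h₃.trans h⟩
      · exact .inr ⟨a, by simp [ha], h₃⟩

theorem reservation_spec (c : ℝ) {X : List (ℝ × ℝ)} (hX : X ≠ []) :
    (∀ a ∈ X, candidate c X a ≤ reservation c X) ∧ ∃ a ∈ X, reservation c X = candidate c X a := by
  cases X with
  | nil => exact absurd rfl hX
  | cons h t =>
    obtain ⟨⟨h₁, h₂⟩, h₃⟩ := foldl_max_spec (candidate c (h :: t)) t (candidate c (h :: t) h)
    refine ⟨fun a ha => ?_, ?_⟩
    · rcases List.mem_cons.1 ha with rfl | ha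
      · exact h₁
      · exact h₂ a ha
    · rcases h₃ with h₃ | ⟨a, ha, h₃⟩
      · exact ⟨h, by simp, h₃⟩
      · exact ⟨a, by simp [ha], h₃⟩

/-- Each selected term `p * (v - u)` is at most `p * (v - u)⁺`, and the omitted terms of the right
side are nonnegative. Selecting exactly the atoms above `u` gives equality, as the next lemma
records. Hence the excess is a maximum of linear functions of `u`, and its level `c` is attained at
the greatest of their roots. -/
theorem filter_sum_le_atomsMean (P : ℝ × ℝ → Bool) (u : ℝ) {X : List (ℝ × ℝ)}
    (hX : ∀ a ∈ X, 0 ≤ a.2) :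
    ((X.filter P).map fun b => b.2 * b.1).sum - ((X.filter P).map Prod.snd).sum * u ≤
      atomsMean X fun y => max (y - u) 0 := by
  induction X with
  | nil => simp
  | cons b X ih =>
    have h₁ := ih fun a ha => hX a (List.mem_cons_of_mem _ ha)
    have h₂ := hX b List.mem_cons_self
    have h₃ := mul_le_mul_of_nonneg_left (le_max_left (b.1 - u) 0) h₂
    have h₄ := mul_nonneg h₂ (le_max_right (b.1 - u) 0)
    rw [atomsMean_cons, List.filter_cons]
    split_ifs
    · simp only [List.map_cons, List.sum_cons]
      linarith
    · linarith

theorem filter_sum_eq_atomsMean {P : ℝ × ℝ → Bool} {u : ℝ} {X : List (ℝ × ℝ)}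
    (hP : ∀ a ∈ X, P a = true ↔ u < a.1) :
    ((X.filter P).map fun b => b.2 * b.1).sum - ((X.filter P).map Prod.snd).sum * u =
      atomsMean X fun y => max (y - u) 0 := by
  induction X with
  | nil => simp
  | cons b X ih =>
    have h₁ := ih fun a ha => hP a (List.mem_cons_of_mem _ ha)
    have h₂ := hP b List.mem_cons_self
    rw [atomsMean_cons, List.filter_cons]
    split_ifs with h
    · rw [max_eq_left (sub_nonneg.2 (h₂.1 h).le)]
      simp only [List.map_cons, List.sum_cons]
      linarith
    · rw [max_eq_right (sub_nonpos.2 (not_lt.1 fun h' => h (h₂.2 h')))]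
      linarith

/-- The defining property of the reservation value. -/
theorem atomsMean_reservation {c : ℝ} (hc : 0 ≤ c) {X : List (ℝ × ℝ)} (hX : X ≠ [])
    (hpos : ∀ a ∈ X, 0 < a.2) :
    atomsMean X (fun y => max (y - reservation c X) 0) = c := by
  obtain ⟨h₁, a₀, ha₀, h₂⟩ := reservation_spec c hX
  set g := reservation c X
  have hP : ∀ a ∈ X, 0 < ((X.filter fun b => decide (a.1 ≤ b.1)).map Prod.snd).sum := by
    intro a ha
    refine List.sum_pos _ (fun x hx => ?_) ?_
    · obtain ⟨b, hb, rfl⟩ := List.mem_map.1 hx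
      exact hpos b (List.mem_filter.1 hb).1
    · have : a ∈ X.filter fun b => decide (a.1 ≤ b.1) := List.mem_filter.2 ⟨ha, by simp⟩
      intro h
      rw [List.map_eq_nil_iff.1 h] at this
      exact absurd this (by simp)
  refine le_antisymm ?_ ?_
  -- Upper bound on the excess at `g`. With `a` the least atom above `g`, the atoms used by the
  -- candidate of `a` are exactly those above `g`, and this candidate is at most `g`.
  · by_cases hg : ∃ b ∈ X, g < b.1
    · have hne : (X.toFinset.filter fun b => g < b.1).Nonempty := by
        obtain ⟨b, hb, hgb⟩ := hg
        exact ⟨b, by simp [hb, hgb]⟩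
      obtain ⟨a, ha, hmin⟩ := Finset.exists_min_image _ Prod.fst hne
      simp only [Finset.mem_filter, List.mem_toFinset] at ha hmin
      rw [← filter_sum_eq_atomsMean (P := fun b => decide (a.1 ≤ b.1)) fun b hb => by
        rw [decide_eq_true_iff]
        exact ⟨fun h => ha.2.trans_le h, fun h => hmin b ⟨hb, h⟩⟩]
      have := h₁ a ha.1
      rw [candidate, div_le_iff₀ (hP a ha.1)] at this
      linarith
    -- No atom exceeds `g`, so the excess is zero, which is at most `c`.
    · push Not at hg
      rw [← filter_sum_eq_atomsMean (P := fun _ => false) fun b hb => by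
        simpa using hg b hb]
      simpa using hc
  -- Lower bound: `g` is the candidate of `a₀`, so the atoms from `a₀` on already give a sum equal
  -- to `c`.
  · have h₃ := filter_sum_le_atomsMean (fun b => decide (a₀.1 ≤ b.1)) g fun a ha => (hpos a ha).le
    rw [candidate, eq_div_iff (hP a₀ ha₀).ne'] at h₂
    linarith

/-! ## Indices of the states of a Markov chain -/

/-- The expectation of `h` under `d`. -/
noncomputable def FinDist.mean (d : FinDist) (h : ℝ → ℝ) : ℝ := ∑ j, d.prob j * h (d.val j)

/-- A distribution given by its sorted list of weighted atoms. -/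
noncomputable def FinDist.ofList (l : List (ℝ × ℝ)) (hs : AtomsSorted l) (hp : ∀ a ∈ l, 0 < a.2)
    (h1 : atomsMean l (fun _ => 1) = 1) : FinDist where
  card := l.length
  val j := (l.get j).1
  prob j := (l.get j).2
  val_strictMono := fun _ _ h => List.pairwise_iff_get.1 hs _ _ h
  prob_pos _ := hp _ (List.get_mem _ _)
  prob_sum := by
    rw [← List.sum_ofFn, ← h1]
    simp only [atomsMean, mul_one]
    congr 1
    rw [← List.ofFn_get l, List.map_ofFn, List.ofFn_get]
    rfl

theorem FinDist.mean_ofList {l : List (ℝ × ℝ)} (hs hp h1) (h : ℝ → ℝ) :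
    (FinDist.ofList l hs hp h1).mean h = atomsMean l h := by
  rw [FinDist.mean, ← List.sum_ofFn, atomsMean]
  congr 1
  conv_rhs => rw [← List.ofFn_get l, List.map_ofFn]
  rfl

theorem FinDist.ofFn_ofList {l : List (ℝ × ℝ)} (hs hp h1) :
    (List.ofFn fun j => ((FinDist.ofList l hs hp h1).val j, (FinDist.ofList l hs hp h1).prob j)) =
      l := by
  exact List.ofFn_get l

theorem FinDist.mean_mono {d : FinDist} {h h' : ℝ → ℝ} (hh : ∀ x, h x ≤ h' x) :
    d.mean h ≤ d.mean h' :=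
  Finset.sum_le_sum fun j _ => mul_le_mul_of_nonneg_left (hh _) (d.prob_pos j).le

/-- Expresses membership in the support through means, so that supports of surrogate laws can be
read off the recursion in `ChainIndex`. -/
theorem FinDist.mean_indicator_pos {d : FinDist} {x : ℝ} :
    0 < d.mean (fun y => if y = x then 1 else 0) ↔ x ∈ Set.range d.val := by
  constructor
  · intro h
    by_contra hx
    refine h.ne' (Finset.sum_eq_zero fun j _ => ?_)
    exact mul_eq_zero_of_right _ (if_neg fun h => hx ⟨j, h⟩)
  · rintro ⟨j, rfl⟩
    refine Finset.sum_pos' (fun k _ => ?_) ⟨j, Finset.mem_univ _, ?_⟩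
    · exact mul_nonneg (d.prob_pos k).le (by beta_reduce; split_ifs <;> norm_num)
    · simpa using d.prob_pos j

/-- Indices of the states of a Markov chain, together with the distributions of the least index
met on the way to a terminal state. -/
structure ChainIndex (M : MarkovChain) where
  idx : M.State → ℝ
  law : M.State → FinDist
  idx_terminal : ∀ s, M.terminal s = true → idx s = M.value s
  mean_terminal : ∀ s, M.terminal s = true → ∀ h, (law s).mean h = h (idx s)
  mean_nonterminal : ∀ s, M.terminal s = false → ∀ h,
    (law s).mean h = ∑ r, M.trans s r * (law r).mean fun y => h (min y (idx s))
  mean_excess : ∀ s, M.terminal s = false →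
    ∑ r, M.trans s r * (law r).mean (fun y => max (y - idx s) 0) = M.cost s

/-- A transition of positive probability. -/
def MarkovChain.Step (M : MarkovChain) (s r : M.State) : Prop :=
  M.terminal s = false ∧ 0 < M.trans s r

open Classical in
/-- The number of states that can be reached from `s`. -/
noncomputable def MarkovChain.rank (M : MarkovChain) (s : M.State) : ℕ :=
  (Finset.univ.filter fun r => Relation.TransGen M.Step s r).card

/-- Whatever is reachable from `r` is reachable from `s`; the state `r` itself is reachable from `s`
but, by acyclicity, not from `r`. -/
theorem MarkovChain.rank_lt {M : MarkovChain} {s r : M.State} (h : M.Step s r) :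
    M.rank r < M.rank s := by
  refine Finset.card_lt_card (Finset.ssubset_iff_of_subset ?_ |>.2 ⟨r, ?_, ?_⟩)
  · intro q hq
    simp only [Finset.mem_filter, Finset.mem_univ, true_and] at hq ⊢
    exact .head h hq
  · simpa using Relation.TransGen.single h
  · simpa using show ¬ Relation.TransGen M.Step r r from M.acyclic r

theorem MarkovChain.rank_le (M : MarkovChain) (s : M.State) : M.rank s ≤ M.m := by
  have : M.rank s < (Finset.univ : Finset M.State).card := by
    refine Finset.card_lt_card (Finset.ssubset_iff_of_subset (Finset.subset_univ _) |>.2 ⟨s, ?_, ?_⟩)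
    · simp
    · simpa using show ¬ Relation.TransGen M.Step s s from M.acyclic s
  rw [Finset.card_fin] at this
  omega

theorem MarkovChain.exists_step {M : MarkovChain} {s : M.State} (hs : M.terminal s = false) :
    ∃ r, M.Step s r := by
  by_contra! h
  have : ∑ r, M.trans s r ≤ 0 := Finset.sum_nonpos fun r _ => not_lt.1 fun h' => h r ⟨hs, h'⟩
  rw [M.trans_sum s hs] at this
  linarith

/-! ### Convergence of the table of indices and its defining equations -/

namespace MarkovChain

variable (M : MarkovChain)

/-- A state as data. -/
noncomputable def encState (s : M.State) : Ty.state.Val :=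
  if M.terminal s then .inl (M.value s) else .inr (M.cost s, List.ofFn (M.trans s))

/-- The entry of a state after some rounds of computation. -/
noncomputable def entryAfter (k : ℕ) (s : M.State) : Ty.entry.Val :=
  entryStep ((entryRound (List.ofFn M.encState))^[k] []) (M.encState s)

theorem iterate_entryRound (k : ℕ) :
    (entryRound (List.ofFn M.encState))^[k + 1] [] = List.ofFn (M.entryAfter k) := by
  rw [Function.iterate_succ_apply', entryRound, List.map_ofFn]
  rfl

/-- Only successors of positive probability influence the entry, and their rank is smaller, so
entries become stable in the order of ranks. At rank zero the state must be terminal, since a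
nonterminal one has a successor. -/
theorem entryAfter_succ_eq {k : ℕ} {s : M.State} (h : M.rank s ≤ k) :
    M.entryAfter (k + 1) s = M.entryAfter k s := by
  induction k generalizing s with
  | zero =>
    cases hs : M.terminal s with
    | true => simp [entryAfter, encState, hs, entryStep]
    | false =>
      obtain ⟨r, hr⟩ := exists_step hs
      exact absurd (rank_lt hr) (by omega)
  | succ k ih =>
    cases hs : M.terminal s with
    | true => simp [entryAfter, encState, hs, entryStep]
    | false =>
      rw [entryAfter, entryAfter, iterate_entryRound, iterate_entryRound]
      simp only [encState, hs, entryStep, Bool.false_eq_true, if_false, Sum.elim_inr]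
      rw [mix_congr fun r hr => ih (s := r) ?_]
      have := rank_lt (M := M) (s := s) (r := r) ⟨hs, hr⟩
      omega

/-- The computed entry of a state. -/
noncomputable def entry (s : M.State) : Ty.entry.Val := M.entryAfter M.m s

theorem entryTable_eq : entryTable (List.ofFn M.encState) = List.ofFn M.entry := by
  rw [CICS.entryTable_eq, List.length_ofFn]
  exact M.iterate_entryRound M.m

/-- All ranks are at most `m`, so the final table is a fixed point of the round. The later facts
about entries use this equation and no longer the iteration. -/
theorem entry_eq (s : M.State) :
    M.entry s = entryStep (List.ofFn M.entry) (M.encState s) := by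
  conv_lhs => rw [entry, ← entryAfter_succ_eq M (M.rank_le s), entryAfter, iterate_entryRound]
  rfl

variable {M}

theorem entry_terminal {s : M.State} (hs : M.terminal s = true) :
    M.entry s = ((M.value s, encBool true), [(M.value s, 1)]) := by
  rw [entry_eq]
  simp [encState, hs, entryStep, encBool]

theorem entry_nonterminal {s : M.State} (hs : M.terminal s = false) :
    M.entry s = nonterminalEntry (M.cost s)
      (normalize (mix (List.ofFn (M.trans s)) (List.ofFn M.entry))) := by
  rw [entry_eq]
  simp [encState, hs, entryStep]

theorem entry_flag (s : M.State) : (M.entry s).1.2 = encBool (M.terminal s) := by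
  cases hs : M.terminal s with
  | true => rw [entry_terminal hs]
  | false => rw [entry_nonterminal hs]; rfl

theorem entry_sorted (s : M.State) : AtomsSorted (M.entry s).2 := by
  rw [entry_eq]; exact entryStep_sorted _ _

theorem entry_pos (s : M.State) : ∀ a ∈ (M.entry s).2, 0 < a.2 := by
  cases hs : M.terminal s with
  | true => rw [entry_terminal hs]; simp
  | false => rw [entry_nonterminal hs]; exact normalize_pos _

theorem atomsMean_mixture {s : M.State} (hs : M.terminal s = false) (f : ℝ → ℝ) :
    atomsMean (normalize (mix (List.ofFn (M.trans s)) (List.ofFn M.entry))) f =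
      ∑ r, M.trans s r * atomsMean (M.entry r).2 f := by
  rw [atomsMean_normalize, atomsMean_mix (M.trans_nonneg s hs)]
  refine mix_nonneg fun e he => ?_
  obtain ⟨r, rfl⟩ := (List.mem_ofFn' _ _).1 he
  exact fun a ha => (entry_pos r a ha).le

theorem atomsMean_entry_nonterminal {s : M.State} (hs : M.terminal s = false) (f : ℝ → ℝ) :
    atomsMean (M.entry s).2 f =
      ∑ r, M.trans s r * atomsMean (M.entry r).2 fun y => f (min y (M.entry s).1.1) := by
  rw [← atomsMean_mixture hs]
  rw [entry_nonterminal hs]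
  simp only [nonterminalEntry]
  rw [atomsMean_normalize, atomsMean_capAll]
  intro a ha
  obtain ⟨b, hb, rfl⟩ := List.mem_map.1 ha
  exact (normalize_pos _ b hb).le

/-- Capping preserves mass and the transition probabilities sum to one; the induction over ranks
reaches every successor of positive probability. -/
theorem entry_total (s : M.State) : atomsMean (M.entry s).2 (fun _ => 1) = 1 := by
  induction hk : M.rank s using Nat.strong_induction_on generalizing s with
  | _ k ih =>
    cases hs : M.terminal s with
    | true => simp [entry_terminal hs]
    | false =>
      rw [atomsMean_entry_nonterminal hs]
      refine Eq.trans ?_ (M.trans_sum s hs)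
      refine Finset.sum_congr rfl fun r _ => ?_
      rcases (M.trans_nonneg s hs r).eq_or_lt with h | h
      · simp [← h]
      · rw [ih _ (hk ▸ rank_lt ⟨hs, h⟩) r rfl, mul_one]

theorem entry_excess {s : M.State} (hs : M.terminal s = false) :
    ∑ r, M.trans s r * atomsMean (M.entry r).2 (fun y => max (y - (M.entry s).1.1) 0) =
      M.cost s := by
  rw [← atomsMean_mixture hs]
  rw [entry_nonterminal hs]
  -- The mixture is not the empty list because its total mass is 1, so the default index 0 is not
  -- used.
  refine atomsMean_reservation (M.cost_nonneg s hs) (fun h => ?_) (normalize_pos _)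
  have := atomsMean_mixture hs fun _ => 1
  simp only [entry_total, mul_one, M.trans_sum s hs, h, atomsMean_nil] at this
  norm_num at this

variable (M)

/-- The computed indices. -/
noncomputable def index : ChainIndex M where
  idx s := (M.entry s).1.1
  law s := .ofList (M.entry s).2 (entry_sorted s) (entry_pos s) (entry_total s)
  idx_terminal s hs := by rw [entry_terminal hs]
  mean_terminal s hs h := by
    rw [FinDist.mean_ofList, entry_terminal hs]
    simp
  mean_nonterminal s hs h := by
    simp only [FinDist.mean_ofList]
    exact atomsMean_entry_nonterminal hs h
  mean_excess s hs := by
    simp only [FinDist.mean_ofList]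
    exact entry_excess hs

end MarkovChain

/-! ### Supports of the surrogate laws -/

namespace ChainIndex

variable {M : MarkovChain} (I : ChainIndex M) {s r : M.State}

theorem range_terminal (hs : M.terminal s = true) : Set.range (I.law s).val = {I.idx s} := by
  ext x
  rw [← FinDist.mean_indicator_pos, I.mean_terminal s hs]
  split_ifs with h
  · simp [h]
  · simp [Ne.symm h]

theorem min_mem_range (hs : M.terminal s = false) (hr : 0 < M.trans s r) {y : ℝ}
    (hy : y ∈ Set.range (I.law r).val) : min y (I.idx s) ∈ Set.range (I.law s).val := by
  rw [← FinDist.mean_indicator_pos, I.mean_nonterminal s hs]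
  refine Finset.sum_pos' (fun q _ => mul_nonneg (M.trans_nonneg s hs q) ?_)
    ⟨r, Finset.mem_univ _, mul_pos hr ?_⟩
  · exact Finset.sum_nonneg fun j _ => mul_nonneg ((I.law q).prob_pos j).le
      (by beta_reduce; split_ifs <;> norm_num)
  · refine (FinDist.mean_indicator_pos.2 hy).trans_le (FinDist.mean_mono fun x => ?_)
    by_cases h : x = y
    · simp [h]
    · rw [if_neg h]
      split_ifs <;> norm_num

theorem le_idx_of_mem_range {x : ℝ} (hx : x ∈ Set.range (I.law s).val) : x ≤ I.idx s := by
  cases hs : M.terminal s with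
  | true => rw [I.range_terminal hs] at hx; exact le_of_eq hx
  | false =>
    by_contra! h
    rw [← FinDist.mean_indicator_pos, I.mean_nonterminal s hs] at hx
    refine hx.ne' (Finset.sum_eq_zero fun r _ => mul_eq_zero_of_right _ ?_)
    refine Finset.sum_eq_zero fun j _ => mul_eq_zero_of_right _ (if_neg fun h' => ?_)
    exact absurd (min_le_right ((I.law r).val j) (I.idx s)) (by rw [h']; exact not_le.2 h)

end ChainIndex

/-! ## Expectations under product distributions -/

section Expect

variable {n : ℕ} {D D' : Fin n → FinDist} {f g : (Fin n → ℝ) → ℝ}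

theorem expect_nonneg_weight (D : Fin n → FinDist) (j : ∀ i, Fin (D i).card) :
    0 ≤ ∏ i, (D i).prob (j i) :=
  Finset.prod_nonneg fun i _ => ((D i).prob_pos _).le

theorem expect_congr (h : ∀ x, InSupport D x → f x = g x) : expect D f = expect D g :=
  Finset.sum_congr rfl fun j _ => by rw [h _ fun i => ⟨j i, rfl⟩]

theorem expect_mono (h : ∀ x, f x ≤ g x) : expect D f ≤ expect D g :=
  Finset.sum_le_sum fun j _ => mul_le_mul_of_nonneg_left (h _) (expect_nonneg_weight D j)

theorem expect_add : expect D (fun x => f x + g x) = expect D f + expect D g := by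
  simp only [expect, mul_add, Finset.sum_add_distrib]

theorem expect_const (c : ℝ) : expect D (fun _ => c) = c := by
  rw [expect, ← Finset.sum_mul, ← Fintype.prod_sum]
  simp [FinDist.prob_sum]

theorem expect_sum_mul {ι : Type*} (s : Finset ι) (p : ι → ℝ) (F : ι → (Fin n → ℝ) → ℝ) :
    expect D (fun x => ∑ r ∈ s, p r * F r x) = ∑ r ∈ s, p r * expect D (F r) := by
  simp only [expect, Finset.mul_sum]
  rw [Finset.sum_comm]
  exact Finset.sum_congr rfl fun _ _ => Finset.sum_congr rfl fun _ _ => by ring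

/-- Insert the coordinate `i` into a vector indexed by the other coordinates. -/
def insertCoord (i : Fin n) (y : ℝ) (z : {k // k ≠ i} → ℝ) : Fin n → ℝ :=
  fun k => if h : k = i then y else z ⟨k, h⟩

theorem update_insertCoord (i : Fin n) (y y' : ℝ) (z : {k // k ≠ i} → ℝ) :
    Function.update (insertCoord i y z) i y' = insertCoord i y' z := by
  ext k
  by_cases h : k = i
  · subst h; simp [insertCoord]
  · simp [insertCoord, h]

/-- Expectation over all coordinates but `i`. -/
noncomputable def expectOff (i : Fin n) (E : {k // k ≠ i} → FinDist)
    (f : ({k // k ≠ i} → ℝ) → ℝ) : ℝ :=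
  ∑ j : (∀ k, Fin (E k).card), (∏ k, (E k).prob (j k)) * f fun k => (E k).val (j k)

theorem expect_split (D : Fin n → FinDist) (f : (Fin n → ℝ) → ℝ) (i : Fin n) :
    expect D f = (D i).mean fun y =>
      expectOff i (fun k => D k) fun z => f (insertCoord i y z) := by
  rw [expect, ← (Equiv.piSplitAt i fun k => Fin (D k).card).symm.sum_comp, Fintype.sum_prod_type,
    FinDist.mean]
  refine Finset.sum_congr rfl fun j₀ _ => ?_
  rw [expectOff, Finset.mul_sum]
  refine Finset.sum_congr rfl fun j _ => ?_
  have h₁ : ∀ k : {k // k ≠ i},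
      (Equiv.piSplitAt i fun k => Fin (D k).card).symm (j₀, j) k = j k := fun k => by
    rw [Equiv.piSplitAt_symm_apply, dif_neg k.2]
  have h₂ : (Equiv.piSplitAt i fun k => Fin (D k).card).symm (j₀, j) i = j₀ := by
    rw [Equiv.piSplitAt_symm_apply, dif_pos rfl]
  have h₃ : (fun k => (D k).val ((Equiv.piSplitAt i fun k => Fin (D k).card).symm (j₀, j) k)) =
      insertCoord i ((D i).val j₀) fun k => (D k).val (j k) := by
    ext k
    by_cases hk : k = i
    · subst hk
      simp only [insertCoord, dif_pos, h₂]
    · simp only [insertCoord, dif_neg hk]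
      rw [← h₁ ⟨k, hk⟩]
  rw [h₃, Fintype.prod_eq_mul_prod_subtype_ne _ i, h₂, mul_assoc]
  simp only [h₁]

theorem mean_const (d : FinDist) (c : ℝ) : d.mean (fun _ => c) = c := by
  rw [FinDist.mean, ← Finset.sum_mul, d.prob_sum, one_mul]

theorem mean_sub (d : FinDist) (h h' : ℝ → ℝ) :
    d.mean (fun y => h y - h' y) = d.mean h - d.mean h' := by
  simp only [FinDist.mean, mul_sub, Finset.sum_sub_distrib]

/-- Replacing the distribution of one coordinate. -/
theorem expect_replace (i : Fin n) (h : ∀ k, k ≠ i → D' k = D k) (f : (Fin n → ℝ) → ℝ) :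
    expect D' f = expect D fun x => (D' i).mean fun y => f (Function.update x i y) := by
  rw [expect_split D' f i, expect_split D _ i]
  simp only [update_insertCoord, mean_const]
  rw [show (fun k : {k // k ≠ i} => D' k) = fun k : {k // k ≠ i} => D k from
    funext fun k => h k k.2]
  simp only [FinDist.mean, expectOff, Finset.mul_sum]
  rw [Finset.sum_comm]
  exact Finset.sum_congr rfl fun _ _ => Finset.sum_congr rfl fun _ _ => by ring

end Expect

/-! ## Surrogate values -/

section Surrogate

variable {n : ℕ} {M : Fin n → MarkovChain} (I : ∀ i, ChainIndex (M i))

/-- The product of the laws of the joint state `s`. -/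
def laws (s : ∀ i, (M i).State) : Fin n → FinDist := fun i => (I i).law (s i)

/-- The effect of advancing chain `i` on an expectation over surrogate values. -/
theorem expect_advance (s : ∀ i, (M i).State) {i : Fin n} (hi : (M i).terminal (s i) = false)
    (f : (Fin n → ℝ) → ℝ) :
    ∑ r, (M i).trans (s i) r * expect (laws I (Function.update s i r)) f =
      expect (laws I s) f + expect (laws I s) fun x => ∑ r, (M i).trans (s i) r *
        ((I i).law r).mean fun y => f (Function.update x i y) -
          f (Function.update x i (min y ((I i).idx (s i)))) := by
  have h₁ : ∀ r, expect (laws I (Function.update s i r)) f =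
      expect (laws I s) fun x => ((I i).law r).mean fun y => f (Function.update x i y) := by
    intro r
    rw [expect_replace i (D := laws I s) (fun k hk => by simp [laws, hk])]
    simp [laws]
  have h₂ : expect (laws I s) f = expect (laws I s) fun x => ∑ r, (M i).trans (s i) r *
      ((I i).law r).mean fun y => f (Function.update x i (min y ((I i).idx (s i)))) := by
    rw [expect_replace i (D' := laws I s) (D := laws I s) fun _ _ => rfl]
    simp only [laws, (I i).mean_nonterminal (s i) hi]
  simp only [h₁]
  rw [← expect_sum_mul]
  conv_rhs => enter [1]; rw [h₂]
  rw [← expect_add]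
  simp only [mean_sub, ← Finset.sum_add_distrib, ← mul_add, add_sub_cancel]

/-- The bracket in `expect_advance` is the excess over the index, whose mean is the cost: paying for
the advance leaves the expectation of `f` unchanged. -/
theorem expect_advance_eq (s : ∀ i, (M i).State) {i : Fin n} (hi : (M i).terminal (s i) = false)
    {f : (Fin n → ℝ) → ℝ}
    (hf : ∀ x y, f (Function.update x i y) - f (Function.update x i (min y ((I i).idx (s i)))) =
      max (y - (I i).idx (s i)) 0) :
    -(M i).cost (s i) + ∑ r, (M i).trans (s i) r * expect (laws I (Function.update s i r)) f =
      expect (laws I s) f := by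
  rw [expect_advance I s hi]
  simp only [hf, (I i).mean_excess (s i) hi, expect_const]
  ring

theorem expect_advance_le (s : ∀ i, (M i).State) {i : Fin n} (hi : (M i).terminal (s i) = false)
    {f : (Fin n → ℝ) → ℝ}
    (hf : ∀ x y, f (Function.update x i y) - f (Function.update x i (min y ((I i).idx (s i)))) ≤
      max (y - (I i).idx (s i)) 0) :
    -(M i).cost (s i) + ∑ r, (M i).trans (s i) r * expect (laws I (Function.update s i r)) f ≤
      expect (laws I s) f := by
  rw [expect_advance I s hi]
  have : (expect (laws I s) fun x => ∑ r, (M i).trans (s i) r *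
      ((I i).law r).mean fun y => f (Function.update x i y) -
        f (Function.update x i (min y ((I i).idx (s i))))) ≤
      expect (laws I s) fun _ => (M i).cost (s i) := by
    refine expect_mono fun x => ?_
    rw [← (I i).mean_excess (s i) hi]
    exact Finset.sum_le_sum fun r _ => mul_le_mul_of_nonneg_left
      (FinDist.mean_mono fun y => hf x y) ((M i).trans_nonneg (s i) hi r)
  rw [expect_const] at this
  linarith

theorem sub_min_eq_max (y g : ℝ) : y - min y g = max (y - g) 0 := by
  rcases le_total y g with h | h
  · rw [min_eq_left h, max_eq_right (sub_nonpos.2 h), sub_self]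
  · rw [min_eq_right h, max_eq_left (sub_nonneg.2 h)]

variable {I}

theorem eq_idx_of_inSupport {s : ∀ i, (M i).State} {x : Fin n → ℝ} (hx : InSupport (laws I s) x)
    {i : Fin n} (hi : (M i).terminal (s i) = true) : x i = (I i).idx (s i) := by
  have := hx i
  rwa [laws, (I i).range_terminal hi] at this

/-- The surrogate values bound the utility of every policy. -/
theorem util_le_expect {F : Constraint n} {s : ∀ i, (M i).State} (π : Policy F M s) :
    π.util ≤ expect (laws I s) fun x =>
      F.sets.sup' ⟨∅, F.empty_mem⟩ fun S => ∑ i ∈ S, x i := by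
  induction π with
  | @halt s S hS hT =>
    rw [Policy.util, ← expect_const (D := laws I s) (∑ i ∈ S, (M i).value (s i))]
    rw [expect_congr (g := fun x => ∑ i ∈ S, x i) fun x hx => Finset.sum_congr rfl fun i hi => by
      rw [eq_idx_of_inSupport hx (hT i hi), (I i).idx_terminal _ (hT i hi)]]
    exact expect_mono fun x => Finset.le_sup' (fun S => ∑ i ∈ S, x i) hS
  | @advance s i hi next ih =>
    rw [Policy.util]
    refine le_trans ?_ (expect_advance_le I s hi fun x y => ?_)
    · gcongr with r
      · exact (M i).trans_nonneg _ hi r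
      · exact ih r
    -- For a fixed set `S`, raising coordinate `i` from `min y g` to `y` adds the excess if `i ∈ S`
    -- and nothing otherwise; the maximum over `S` inherits the bound.
    · rw [sub_le_iff_le_add]
      refine Finset.sup'_le _ _ fun S hS => ?_
      refine le_trans ?_ (add_le_add_right (Finset.le_sup' (fun S => ∑ k ∈ S,
        Function.update x i (min y ((I i).idx (s i))) k) hS) _)
      by_cases hiS : i ∈ S
      · rw [Finset.sum_update_of_mem hiS, Finset.sum_update_of_mem hiS, ← sub_min_eq_max]
        linarith
      · rw [Finset.sum_update_of_notMem hiS, Finset.sum_update_of_notMem hiS]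
        linarith [le_max_right (y - (I i).idx (s i)) 0]

end Surrogate

/-! ## Semi-online procedures -/

namespace SemiOnline

variable {n : ℕ} {F : Constraint n}

theorem subset_accepted {S : Finset (Fin n)} (A : SemiOnline F S) (x : Fin n → ℝ) :
    S ⊆ A.accepted x := by
  induction A with
  | halt => exact subset_rfl
  | probe i hi hF θ yes no ihy ihn =>
    rw [accepted]
    split_ifs
    · exact (Finset.subset_insert _ _).trans ihy
    · exact ihn

/-- Accepted elements are never probed again, so the remaining procedure cannot depend on their
values. -/
theorem accepted_congr {S : Finset (Fin n)} (A : SemiOnline F S) {x x' : Fin n → ℝ}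
    (h : ∀ i ∉ S, x i = x' i) : A.accepted x = A.accepted x' := by
  induction A with
  | halt => rfl
  | probe i hi hF θ yes no ihy ihn =>
    rw [accepted, accepted, h i hi, ihn h,
      ihy fun k hk => h k fun hk' => hk (Finset.mem_insert_of_mem hk')]

theorem follows_congr {a : Ty} {B : SemiOnlineAlg a} {S : Finset (Fin n)} (A : SemiOnline F S)
    {x x' : Fin n → ℝ} (h : ∀ i ∉ S, x i = x' i) {c t} (hx : A.Follows B x c t) :
    A.Follows B x' c t := by
  induction A generalizing c t with
  | halt => exact hx
  | probe i hi hF θ yes no ihy ihn =>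
    obtain ⟨hc, d, t₁, t₂, hr, ht, hy, hn⟩ := hx
    rw [h i hi] at hr hy hn
    exact ⟨hc, d, t₁, t₂, hr, ht,
      fun hθ => ihy (fun k hk => h k fun hk' => hk (Finset.mem_insert_of_mem hk')) (hy hθ),
      fun hθ => ihn h (hn hθ)⟩

theorem follows_mono {a : Ty} {B : SemiOnlineAlg a} {S : Finset (Fin n)} (A : SemiOnline F S)
    {x : Fin n → ℝ} {c} {t t' : ℕ} (htt : t ≤ t') (hx : A.Follows B x c t) :
    A.Follows B x c t' := by
  cases A with
  | halt => exact hx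
  | probe i hi hF θ yes no =>
    obtain ⟨hc, d, t₁, t₂, hr, ht, h⟩ := hx
    exact ⟨hc, d, t₁, t₂, hr, ht.trans htt, h⟩

/-- The value obtained when the values are `x`. -/
noncomputable def gain {S : Finset (Fin n)} (A : SemiOnline F S) (x : Fin n → ℝ) : ℝ :=
  ∑ i ∈ A.accepted x, x i

/-- If `y < θ`, the cap `g ≥ θ` is inactive and nothing changes. If `θ ≤ y`, both values are
answered yes, the continuation ignores coordinate `i`, and since `i` stays accepted the gains differ
by `y - min y g`. -/
theorem gain_update_sub {S : Finset (Fin n)} {i : Fin n} {hi : i ∉ S} {hF : insert i S ∈ F.sets}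
    {θ g : ℝ} (hg : θ ≤ g) {yes : SemiOnline F (insert i S)} {no : SemiOnline F S}
    (x : Fin n → ℝ) (y : ℝ) :
    (probe i hi hF θ yes no).gain (Function.update x i y) -
      (probe i hi hF θ yes no).gain (Function.update x i (min y g)) = max (y - g) 0 := by
  rcases lt_or_ge y θ with h | h
  · rw [min_eq_left (h.le.trans hg), max_eq_right (sub_nonpos.2 (h.le.trans hg)), sub_self]
  · simp only [gain, accepted, Function.update_self, if_pos h, if_pos (le_min h hg)]
    rw [accepted_congr yes (x := Function.update x i y) (x' := Function.update x i (min y g))]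
    · have hm := subset_accepted yes (Function.update x i (min y g)) (Finset.mem_insert_self i S)
      rw [Finset.sum_update_of_mem hm, Finset.sum_update_of_mem hm, ← sub_min_eq_max]
      ring
    · intro k hk
      have : k ≠ i := fun h => hk (h ▸ Finset.mem_insert_self i S)
      simp [this]

end SemiOnline

/-! ## The policy simulating a semi-online algorithm -/

/-- The index of a state and whether it is terminal. -/
abbrev Ty.cell : Ty := .prod .real .bool

/-- Configurations of the simulation: the configuration of the semi-online algorithm, the table of
the cells of all states, the cells of the current states, and the chains accepted so far. -/
abbrev Ty.sim (mem : Ty) : Ty :=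
  .prod (.prod mem (.sum .unit (.prod .nat .real)))
    (.prod (.list (.list .cell)) (.prod (.list .cell) (.list .nat)))

/-- The reaction to a probe of a chain: answer it, or advance the chain first. -/
noncomputable def reaction (i : List Unit) (θ : ℝ) (cur : List Ty.cell.Val) :
    (Ty.sum .bool .unit).Val :=
  if θ ≤ (cur.getD i.length (0, .inl ())).1 then
    Sum.elim (fun _ => .inl (.inl ())) (fun _ => .inr ()) (cur.getD i.length (0, .inl ())).2
  else .inl (.inr ())

/-- The cells of the current states after the probed chain has moved to state `r`. -/
noncomputable def moveCells (act : (Ty.sum .unit (.prod .nat .real)).Val)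
    (tabs : List (List Ty.cell.Val)) (cur : List Ty.cell.Val) (r : List Unit) :
    List Ty.cell.Val :=
  Sum.elim (fun _ => cur) (fun p => cur.set p.1.length
    ((tabs.getD p.1.length []).getD r.length (0, .inl ()))) act

theorem poly_reaction : Poly (a := .prod (.prod .nat .real) (.list .cell))
    (b := .sum .bool .unit) (fun z => reaction z.1.1 z.1.2 z.2) := by
  have hg : Poly (a := .prod (.prod .nat .real) (.list .cell)) (b := .cell)
      (fun z => z.2.getD z.1.1.length (0, .inl ())) :=
    .getD (.fst (.fst .id)) (.snd .id) (.pair (.const 0) (.inl .unit))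
  have he := Poly.sumElim (b := .unit) (c := .unit) (d := .sum .bool .unit)
    (f := fun _ => .inl (.inl ())) (g := fun _ => .inr ()) (.snd hg)
    (.inl (.inl .unit)) (.inr .unit)
  exact .ite_le (.snd (.fst .id)) (.fst hg) he (.inl (.inr .unit))

theorem poly_moveCells :
    Poly (a := .prod (.prod (.sum .unit (.prod .nat .real))
      (.prod (.list (.list .cell)) (.list .cell))) .nat) (b := .list .cell)
      (fun z => moveCells z.1.1 z.1.2.1 z.1.2.2 z.2) := by
  have hg : Poly (a := .prod (.prod .nat .real) (.prod (.prod (.sum .unit (.prod .nat .real))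
      (.prod (.list (.list .cell)) (.list .cell))) .nat)) (b := .list .cell)
      (fun w => w.2.1.2.1.getD w.1.1.length []) :=
    .getD (.fst (.fst .id)) (.fst (.snd (.fst (.snd .id)))) .nil
  have hg' : Poly (a := .prod (.prod .nat .real) (.prod (.prod (.sum .unit (.prod .nat .real))
      (.prod (.list (.list .cell)) (.list .cell))) .nat)) (b := .cell)
      (fun w => (w.2.1.2.1.getD w.1.1.length []).getD w.2.2.length (0, .inl ())) :=
    .getD (.snd (.snd .id)) hg (.pair (.const 0) (.inl .unit))
  have hs : Poly (a := .prod (.prod .nat .real) (.prod (.prod (.sum .unit (.prod .nat .real))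
      (.prod (.list (.list .cell)) (.list .cell))) .nat)) (b := .list .cell)
      (fun w => w.2.1.2.2.set w.1.1.length
        ((w.2.1.2.1.getD w.1.1.length []).getD w.2.2.length (0, .inl ()))) :=
    .set (.fst (.fst .id)) (.snd (.snd (.fst (.snd .id)))) hg'
  exact .sumElim (a := .prod (.prod (.sum .unit (.prod .nat .real))
      (.prod (.list (.list .cell)) (.list .cell))) .nat) (b := .unit) (c := .prod .nat .real)
      (d := .list .cell) (s := fun z => z.1.1) (f := fun w => w.2.1.2.2)
      (.fst (.fst .id)) (.snd (.snd (.fst (.snd .id)))) hs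

/-! ### The simulating program and its running times -/

section Program

variable {a : Ty} (B : SemiOnlineAlg a)
  (pd : Prog (.prod (.prod .nat .real) (.list .cell)) (.sum .bool .unit))
  (pu : Prog (.prod (.prod (.sum .unit (.prod .nat .real))
    (.prod (.list (.list .cell)) (.list .cell))) .nat) (.list .cell))
  (pin : Prog .chains (.prod .dists (.prod (.list (.list .cell)) (.list .cell))))

/-- One step of the simulation: react to the pending action of the semi-online algorithm. -/
def simBody : Prog (.sim B.mem) (.sum (.sim B.mem) (.prod (.sim B.mem) (.sum (.list .nat) .nat))) :=
  .comp (.case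
    (.comp .inr (.pair .snd (.comp .inl (.comp .snd (.comp .snd (.comp .snd .snd))))))
    (.comp (.case
      (.comp .inl (.pair
        (.comp B.next (.pair (.comp .fst (.comp .fst (.comp .snd .snd))) .fst))
        (.pair (.comp .fst (.comp .snd (.comp .snd .snd)))
          (.pair (.comp .fst (.comp .snd (.comp .snd (.comp .snd .snd))))
            (.case
              (.comp .cons (.pair (.comp .fst (.comp .fst .snd))
                (.comp .snd (.comp .snd (.comp .snd (.comp .snd .snd))))))
              (.comp .snd (.comp .snd (.comp .snd (.comp .snd .snd)))))))))
      (.comp .inr (.pair (.comp .snd .snd) (.comp .inr (.comp .fst (.comp .fst .snd))))))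
      (.pair (.comp pd (.pair .fst (.comp .fst (.comp .snd (.comp .snd .snd))))) .id)))
    (.pair (.comp .snd .fst) .id)

/-- Resume the simulation when the advanced chain has moved. -/
def simNext : Prog (.prod (.sim B.mem) .nat) (.sim B.mem) :=
  .pair (.comp .fst .fst) (.pair (.comp .fst (.comp .snd .fst))
    (.pair (.comp pu (.pair (.pair (.comp .snd (.comp .fst .fst))
        (.pair (.comp .fst (.comp .snd .fst)) (.comp .fst (.comp .snd (.comp .snd .fst))))) .snd))
      (.comp .snd (.comp .snd (.comp .snd .fst)))))

/-- Prepare the simulation. -/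
def simStart : Prog (.prod a .chains) (.sim B.mem) :=
  .comp (.pair (.comp B.start (.pair .fst (.comp .fst .snd)))
    (.pair (.comp .fst (.comp .snd .snd)) (.pair (.comp .snd (.comp .snd .snd)) .nil)))
    (.pair .fst (.comp pin .snd))

/-- The algorithmic policy simulating `B`. -/
def simPolicy : PolicyAlg a where
  mem := .sim B.mem
  start := .comp (.loop (simBody B pd)) (simStart B pin)
  next := .comp (.loop (simBody B pd)) (simNext B pu)

variable {B pd pu pin}

open Prog

/-- This and the next three lemmas treat the possible reactions of the loop body: halting and
advancing leave the loop, while answering a probe stays in it. The constants are generous bounds for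
routing data. -/
theorem simBody_halt (m : B.mem.Val) (tabs cur acc) :
    ∃ t ≤ 40, (simBody B pd).Runs ((m, .inl ()), tabs, cur, acc)
      (.inr (((m, .inl ()), tabs, cur, acc), .inl acc)) t :=
  ⟨_, by norm_num, Runs.comp (Runs.pair (Runs.comp (runs_fst _ _) (runs_snd _ _)) (runs_id _))
    (Runs.case_inl (Runs.comp (Runs.pair (runs_snd _ _) (Runs.comp (Runs.comp (Runs.comp
      (Runs.comp (runs_snd _ _) (runs_snd _ _)) (runs_snd _ _)) (runs_snd _ _)) (runs_inl _)))
      (runs_inr _)))⟩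

theorem simBody_advance {m : B.mem.Val} {tabs cur acc} {i : List Unit} {θ : ℝ} {td : ℕ}
    (hd : pd.Runs ((i, θ), cur) (.inr ()) td) :
    ∃ t ≤ td + 60, (simBody B pd).Runs ((m, .inr (i, θ)), tabs, cur, acc)
      (.inr (((m, .inr (i, θ)), tabs, cur, acc), .inr i)) t :=
  ⟨_, by omega, Runs.comp (Runs.pair (Runs.comp (runs_fst _ _) (runs_snd _ _)) (runs_id _))
    (Runs.case_inr (Runs.comp (Runs.pair (Runs.comp (Runs.pair (runs_fst _ _)
      (Runs.comp (Runs.comp (Runs.comp (runs_snd _ _) (runs_snd _ _)) (runs_snd _ _))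
        (runs_fst _ _))) hd) (runs_id _))
      (Runs.case_inr (Runs.comp (Runs.pair (Runs.comp (runs_snd _ _) (runs_snd _ _))
        (Runs.comp (Runs.comp (Runs.comp (runs_snd _ _) (runs_fst _ _)) (runs_fst _ _))
          (runs_inr _))) (runs_inr _)))))⟩

theorem simBody_yes {m : B.mem.Val} {tabs cur acc} {i : List Unit} {θ : ℝ} {td tb : ℕ} {d}
    (hd : pd.Runs ((i, θ), cur) (.inl (.inl ())) td) (hb : B.next.Runs (m, .inl ()) d tb) :
    ∃ t ≤ td + tb + 100, (simBody B pd).Runs ((m, .inr (i, θ)), tabs, cur, acc)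
      (.inl (d, tabs, cur, i :: acc)) t :=
  ⟨_, by omega, Runs.comp (Runs.pair (Runs.comp (runs_fst _ _) (runs_snd _ _)) (runs_id _))
    (Runs.case_inr (Runs.comp (Runs.pair (Runs.comp (Runs.pair (runs_fst _ _)
      (Runs.comp (Runs.comp (Runs.comp (runs_snd _ _) (runs_snd _ _)) (runs_snd _ _))
        (runs_fst _ _))) hd) (runs_id _))
      (Runs.case_inl (Runs.comp (Runs.pair
        (Runs.comp (Runs.pair (Runs.comp (Runs.comp (Runs.comp (runs_snd _ _) (runs_snd _ _))
          (runs_fst _ _)) (runs_fst _ _)) (runs_fst _ _)) hb)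
        (Runs.pair (Runs.comp (Runs.comp (Runs.comp (runs_snd _ _) (runs_snd _ _)) (runs_snd _ _))
          (runs_fst _ _))
          (Runs.pair (Runs.comp (Runs.comp (Runs.comp (Runs.comp (runs_snd _ _) (runs_snd _ _))
            (runs_snd _ _)) (runs_snd _ _)) (runs_fst _ _))
            (Runs.case_inl (Runs.comp (Runs.pair
              (Runs.comp (Runs.comp (runs_snd _ _) (runs_fst _ _)) (runs_fst _ _))
              (Runs.comp (Runs.comp (Runs.comp (Runs.comp (runs_snd _ _) (runs_snd _ _))
                (runs_snd _ _)) (runs_snd _ _)) (runs_snd _ _)))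
              (runs_cons _ _)))))) (runs_inl _)))))⟩

theorem simBody_no {m : B.mem.Val} {tabs cur acc} {i : List Unit} {θ : ℝ} {td tb : ℕ} {d}
    (hd : pd.Runs ((i, θ), cur) (.inl (.inr ())) td) (hb : B.next.Runs (m, .inr ()) d tb) :
    ∃ t ≤ td + tb + 100, (simBody B pd).Runs ((m, .inr (i, θ)), tabs, cur, acc)
      (.inl (d, tabs, cur, acc)) t :=
  ⟨_, by omega, Runs.comp (Runs.pair (Runs.comp (runs_fst _ _) (runs_snd _ _)) (runs_id _))
    (Runs.case_inr (Runs.comp (Runs.pair (Runs.comp (Runs.pair (runs_fst _ _)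
      (Runs.comp (Runs.comp (Runs.comp (runs_snd _ _) (runs_snd _ _)) (runs_snd _ _))
        (runs_fst _ _))) hd) (runs_id _))
      (Runs.case_inl (Runs.comp (Runs.pair
        (Runs.comp (Runs.pair (Runs.comp (Runs.comp (Runs.comp (runs_snd _ _) (runs_snd _ _))
          (runs_fst _ _)) (runs_fst _ _)) (runs_fst _ _)) hb)
        (Runs.pair (Runs.comp (Runs.comp (Runs.comp (runs_snd _ _) (runs_snd _ _)) (runs_snd _ _))
          (runs_fst _ _))
          (Runs.pair (Runs.comp (Runs.comp (Runs.comp (Runs.comp (runs_snd _ _) (runs_snd _ _))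
            (runs_snd _ _)) (runs_snd _ _)) (runs_fst _ _))
            (Runs.case_inr (Runs.comp (Runs.comp (Runs.comp (Runs.comp (runs_snd _ _)
              (runs_snd _ _)) (runs_snd _ _)) (runs_snd _ _)) (runs_snd _ _))))))
        (runs_inl _)))))⟩

theorem simNext_runs {c : (Ty.prod B.mem (.sum .unit (.prod .nat .real))).Val} {tabs cur acc}
    {r : List Unit} {cur' : List Ty.cell.Val} {tu : ℕ}
    (hu : pu.Runs ((c.2, tabs, cur), r) cur' tu) :
    ∃ t ≤ tu + 60, (simNext B pu).Runs ((c, tabs, cur, acc), r) (c, tabs, cur', acc) t :=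
  ⟨_, by omega, Runs.pair (Runs.comp (runs_fst _ _) (runs_fst _ _))
    (Runs.pair (Runs.comp (Runs.comp (runs_fst _ _) (runs_snd _ _)) (runs_fst _ _))
      (Runs.pair (Runs.comp (Runs.pair (Runs.pair
        (Runs.comp (Runs.comp (runs_fst _ _) (runs_fst _ _)) (runs_snd _ _))
        (Runs.pair (Runs.comp (Runs.comp (runs_fst _ _) (runs_snd _ _)) (runs_fst _ _))
          (Runs.comp (Runs.comp (Runs.comp (runs_fst _ _) (runs_snd _ _)) (runs_snd _ _))
            (runs_fst _ _)))) (runs_snd _ _)) hu)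
        (Runs.comp (Runs.comp (Runs.comp (runs_fst _ _) (runs_snd _ _)) (runs_snd _ _))
          (runs_snd _ _))))⟩

theorem simStart_runs {e : a.Val} {x : Ty.chains.Val} {dists tabs cur} {c} {ti tb : ℕ}
    (hi : pin.Runs x (dists, tabs, cur) ti) (hb : B.start.Runs (e, dists) c tb) :
    ∃ t ≤ ti + tb + 60, (simStart B pin).Runs (e, x) (c, tabs, cur, []) t :=
  ⟨_, by omega, Runs.comp (Runs.pair (runs_fst _ _) (Runs.comp (runs_snd _ _) hi))
    (Runs.pair (Runs.comp (Runs.pair (runs_fst _ _) (Runs.comp (runs_snd _ _) (runs_fst _ _))) hb)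
      (Runs.pair (Runs.comp (Runs.comp (runs_snd _ _) (runs_snd _ _)) (runs_fst _ _))
        (Runs.pair (Runs.comp (Runs.comp (runs_snd _ _) (runs_snd _ _)) (runs_snd _ _))
          (runs_nil _))))⟩

end Program

/-! ### Correctness of the simulation -/

section Simulation

variable {n : ℕ} {F : Constraint n} {M : Fin n → MarkovChain} (I : ∀ i, ChainIndex (M i))

/-- The cell of a state. -/
noncomputable def cellOf (i : Fin n) (r : (M i).State) : Ty.cell.Val :=
  ((I i).idx r, encBool ((M i).terminal r))

noncomputable def cellTable : List (List Ty.cell.Val) :=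
  List.ofFn fun i => List.ofFn fun r => cellOf I i r

noncomputable def currentCells (s : ∀ i, (M i).State) : List Ty.cell.Val :=
  List.ofFn fun i => cellOf I i (s i)

theorem length_encNat (m : ℕ) : List.length (encNat m) = m := by simp [encNat]

theorem getD_ofFn {β : Type*} {m : ℕ} (f : Fin m → β) (i : Fin m) (d : β) :
    (List.ofFn f).getD i d = f i := by
  simp [List.getD_eq_getElem?_getD]

theorem set_ofFn {β : Type*} {m : ℕ} (f : Fin m → β) (i : Fin m) (y : β) :
    (List.ofFn f).set i y = List.ofFn (Function.update f i y) := by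
  refine List.ext_getElem (by simp) fun k h₁ h₂ => ?_
  rw [List.getElem_set]
  simp only [List.getElem_ofFn, Function.update_apply, Fin.ext_iff, eq_comm]

theorem reaction_yes {s : ∀ i, (M i).State} {i : Fin n} {θ : ℝ} (hθ : θ ≤ (I i).idx (s i))
    (hi : (M i).terminal (s i) = true) :
    reaction (encNat i) θ (currentCells I s) = .inl (.inl ()) := by
  rw [reaction, length_encNat, currentCells, getD_ofFn]
  simp [cellOf, hθ, hi, encBool]

theorem reaction_advance {s : ∀ i, (M i).State} {i : Fin n} {θ : ℝ} (hθ : θ ≤ (I i).idx (s i))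
    (hi : (M i).terminal (s i) = false) :
    reaction (encNat i) θ (currentCells I s) = .inr () := by
  rw [reaction, length_encNat, currentCells, getD_ofFn]
  simp [cellOf, hθ, hi, encBool]

theorem reaction_no {s : ∀ i, (M i).State} {i : Fin n} {θ : ℝ} (hθ : (I i).idx (s i) < θ) :
    reaction (encNat i) θ (currentCells I s) = .inl (.inr ()) := by
  rw [reaction, length_encNat, currentCells, getD_ofFn]
  exact if_neg (not_le.2 hθ)

theorem moveCells_eq (s : ∀ i, (M i).State) (i : Fin n) (r : (M i).State) (θ : ℝ) :
    moveCells (.inr (encNat i, θ)) (cellTable I) (currentCells I s) (encNat r) =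
      currentCells I (Function.update s i r) := by
  change (currentCells I s).set (List.length (encNat i))
    (((cellTable I).getD (List.length (encNat i)) []).getD (List.length (encNat r)) (0, .inl ())) = _
  rw [length_encNat, length_encNat, cellTable, getD_ofFn, getD_ofFn, currentCells, currentCells,
    set_ofFn]
  congr 1
  ext1 k
  by_cases h : k = i
  · subst h; simp
  · simp [h]

theorem laws_update_self (s : ∀ i, (M i).State) (i : Fin n) (r : (M i).State) :
    laws I (Function.update s i r) i = (I i).law r := by
  simp [laws]

theorem laws_update_of_ne (s : ∀ i, (M i).State) {i k : Fin n} (r : (M i).State) (h : k ≠ i) :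
    laws I (Function.update s i r) k = laws I s k := by
  simp [laws, h]

theorem exists_inSupport (D : Fin n → FinDist) : ∃ x, InSupport D x := by
  have h : ∀ i, ∃ y, y ∈ Set.range (D i).val := fun i => by
    by_contra! h
    have : IsEmpty (Fin (D i).card) := ⟨fun j => h _ ⟨j, rfl⟩⟩
    have := (D i).prob_sum
    simp at this
  choose x hx using h
  exact ⟨x, hx⟩

variable {I}

/-- A pending probe stays valid when the probed chain is advanced. -/
theorem follows_probe_advance {a : Ty} {B : SemiOnlineAlg a} {S : Finset (Fin n)}
    {s : ∀ i, (M i).State} {i : Fin n} {hi : i ∉ S} {hF : insert i S ∈ F.sets} {θ : ℝ}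
    {yes : SemiOnline F (insert i S)} {no : SemiOnline F S} (hθ : θ ≤ (I i).idx (s i))
    (hs : (M i).terminal (s i) = false) {r : (M i).State} (hr : 0 < (M i).trans (s i) r) {c t}
    (h : ∀ x, InSupport (laws I s) x → (SemiOnline.probe i hi hF θ yes no).Follows B x c t)
    {x : Fin n → ℝ} (hx : InSupport (laws I (Function.update s i r)) x) :
    (SemiOnline.probe i hi hF θ yes no).Follows B x c t := by
  -- A surrogate possible after the move becomes possible before it once capped at the old index.
  -- Because `θ` is at most that index, capping does not change the answer.
  have hx' : InSupport (laws I s) (Function.update x i (min (x i) ((I i).idx (s i)))) := by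
    intro k
    by_cases hk : k = i
    · subst hk
      rw [Function.update_self]
      exact (I k).min_mem_range hs hr (laws_update_self I s k r ▸ hx k)
    · rw [Function.update_of_ne hk]
      exact laws_update_of_ne I s r hk ▸ hx k
  obtain ⟨hc, d, t₁, t₂, hrun, ht, hy, hn⟩ := h _ hx'
  rw [Function.update_self] at hrun hy hn
  have hiff : θ ≤ min (x i) ((I i).idx (s i)) ↔ θ ≤ x i := by simp [hθ]
  simp only [hiff] at hrun hy
  refine ⟨hc, d, t₁, t₂, hrun, ht, fun h => ?_, fun h => ?_⟩
  · refine SemiOnline.follows_congr yes (fun k hk => ?_) (hy h)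
    exact Function.update_of_ne (by rintro rfl; exact hk (Finset.mem_insert_self k S)) _ _
  -- After a no the value still matters to the continuation, but then it lies below `θ` and the cap
  -- has not altered it.
  · have hmin : min (x i) ((I i).idx (s i)) = x i := min_eq_left (h.le.trans hθ)
    rw [hmin, Function.update_eq_self] at hn
    exact hn h

/-- All answers to a probe being equal, the algorithm proceeds to a unique configuration. -/
theorem follows_probe_common {a : Ty} {B : SemiOnlineAlg a} {S : Finset (Fin n)}
    {D : Fin n → FinDist} {i : Fin n} {hi : i ∉ S} {hF : insert i S ∈ F.sets} {θ : ℝ}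
    {yes : SemiOnline F (insert i S)} {no : SemiOnline F S} {c t} {b : Bool}
    (hb : ∀ x, InSupport D x → decide (θ ≤ x i) = b)
    (h : ∀ x, InSupport D x → (SemiOnline.probe i hi hF θ yes no).Follows B x c t) :
    c.2 = .inr (encNat i, θ) ∧ ∃ d t₁ t₂, B.next.Runs (c.1, encBool b) d t₁ ∧ t₁ + t₂ ≤ t ∧
      ∀ x, InSupport D x → if b then yes.Follows B x d t₂ else no.Follows B x d t₂ := by
  obtain ⟨x₀, hx₀⟩ := exists_inSupport D
  obtain ⟨hc, d, t₁, t₂, hr, ht, -⟩ := h x₀ hx₀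
  rw [hb x₀ hx₀] at hr
  -- The remaining budget must not depend on `x`. By determinism every `x` reaches `d` after the
  -- same `t₁` steps, so `t - t₁` serves for all.
  refine ⟨hc, d, t₁, t - t₁, hr, by omega, fun x hx => ?_⟩
  obtain ⟨-, d', t₁', t₂', hr', ht', hy, hn⟩ := h x hx
  have hbx := hb x hx
  rw [hbx] at hr'
  obtain ⟨rfl, rfl⟩ := hr.deterministic hr'
  cases b with
  | true => exact SemiOnline.follows_mono _ (by omega) (hy (of_decide_eq_true hbx))
  | false => exact SemiOnline.follows_mono _ (by omega) (hn (not_le.1 (of_decide_eq_false hbx)))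

theorem sum_rank_update_lt {s : ∀ i, (M i).State} {i : Fin n} {r : (M i).State}
    (h : (M i).Step (s i) r) :
    ∑ k, (M k).rank (Function.update s i r k) < ∑ k, (M k).rank (s k) := by
  refine Finset.sum_lt_sum (fun k _ => ?_) ⟨i, Finset.mem_univ _, ?_⟩
  · by_cases hk : k = i
    · subst hk
      simpa using (MarkovChain.rank_lt h).le
    · simp [hk]
  · simpa using MarkovChain.rank_lt h

variable {a : Ty} {B : SemiOnlineAlg a}
  {pd : Prog (.prod (.prod .nat .real) (.list .cell)) (.sum .bool .unit)}
  {pu : Prog (.prod (.prod (.sum .unit (.prod .nat .real))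
    (.prod (.list (.list .cell)) (.list .cell))) .nat) (.list .cell)}
  {pin : Prog .chains (.prod .dists (.prod (.list (.list .cell)) (.list .cell)))}

/-- Charges one answered probe, together with its overhead, to the `t` steps spent by `B`. -/
theorem add_le_step_mul (L : ℕ) {t : ℕ} (ht : 0 < t) : L + t + 200 ≤ (2 * L + 300) * t := by
  nlinarith

theorem map_encNat_lift (l : List (Fin n)) : .inl (l.map fun i : Fin n => encNat i) =
    (.inl (l.map fun i => encNat i) : (Ty.sum (.list .nat) .nat).Val) := by
  congr 1
  induction l with
  | nil => rfl
  | cons i l ih => exact congrArg (encNat i :: ·) ih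

/-- The simulation of a semi-online procedure executes a policy whose utility is the expected gain
of the procedure on the surrogate values. -/
theorem exists_policy_simulating {L : ℕ}
    (hd : ∀ (s : ∀ i, (M i).State) (i : Fin n) (θ : ℝ), ∃ t ≤ L,
      pd.Runs ((encNat i, θ), currentCells I s) (reaction (encNat i) θ (currentCells I s)) t)
    (hu : ∀ (s : ∀ i, (M i).State) (i : Fin n) (r : (M i).State) (θ : ℝ), ∃ t ≤ L,
      pu.Runs ((.inr (encNat i, θ), cellTable I, currentCells I s), encNat r)
        (currentCells I (Function.update s i r)) t)
    {S : Finset (Fin n)} (A : SemiOnline F S) (N : ℕ) (s : ∀ i, (M i).State) (l : List (Fin n))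
    (c : (Ty.prod B.mem (.sum .unit (.prod .nat .real))).Val) (t : ℕ)
    (hN : ∑ i, (M i).rank (s i) ≤ N) (hl : l.toFinset = S) (hS : S ∈ F.sets)
    (hT : ∀ i ∈ S, (M i).terminal (s i) = true)
    (hA : ∀ x, InSupport (laws I s) x → A.Follows B x c t) :
    ∃ π : Policy F M s, π.util = expect (laws I s) A.gain ∧ ∃ c' t₁ t₂,
      (Prog.loop (simBody B pd)).Runs
        (c, cellTable I, currentCells I s, l.map fun i : Fin n => encNat i) c' t₁ ∧
      π.Follows (simPolicy B pd pu pin) c' t₂ ∧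
      t₁ + t₂ ≤ (2 * L + 300) * (t + N + 1) := by
  induction A generalizing N s l c t with
  | @halt S =>
    obtain ⟨x, hx⟩ := exists_inSupport (laws I s)
    have hc : c.2 = .inl () := hA x hx
    obtain ⟨m, _⟩ := c
    subst hc
    obtain ⟨tb, htb, hr⟩ := simBody_halt (B := B) (pd := pd) m (cellTable I) (currentCells I s)
      (l.map fun i : Fin n => encNat i)
    refine ⟨.halt S hS hT, ?_, _, _, 0, hr.loop_done, ⟨l, hl, map_encNat_lift l⟩, ?_⟩
    · rw [Policy.util, ← expect_const (D := laws I s) (∑ i ∈ S, (M i).value (s i))]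
      refine expect_congr fun x hx => Finset.sum_congr rfl fun i hi => ?_
      rw [eq_idx_of_inSupport hx (hT i hi), (I i).idx_terminal _ (hT i hi)]
    · have : (2 * L + 300) * 1 ≤ (2 * L + 300) * (t + N + 1) := Nat.mul_le_mul_left _ (by omega)
      omega
  | @probe S i hi hF θ yes no ihy ihn =>
    -- An advance leaves the same probe pending, so the procedure does not shrink; the sum of the
    -- ranks does.
    induction N using Nat.strong_induction_on generalizing s l c t with
    | _ N ihN =>
    obtain ⟨td, htd, hrd⟩ := hd s i θ
    rcases lt_or_ge ((I i).idx (s i)) θ with hθ | hθ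
    -- The index bounds the surrogate from above, so every possible vector is answered no.
    · have hno : ∀ x, InSupport (laws I s) x → ¬ θ ≤ x i := fun x hx =>
        not_le.2 (((I i).le_idx_of_mem_range (hx i)).trans_lt hθ)
      obtain ⟨hc, d, t₁, t₂, hr, ht, hf⟩ := follows_probe_common (b := false)
        (fun x hx => decide_eq_false (hno x hx)) hA
      obtain ⟨m, _⟩ := c
      subst hc
      rw [reaction_no I hθ] at hrd
      obtain ⟨tb, htb, hrb⟩ := simBody_no (tabs := cellTable I)
        (acc := l.map fun i : Fin n => encNat i) hrd hr
      obtain ⟨π, hπ, c', u₁, u₂, hrun, hfol, hu'⟩ := ihn N s l d t₂ hN hl hS hT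
        (fun x hx => by simpa using hf x hx)
      refine ⟨π, ?_, c', _, u₂, hrb.loop_again hrun, hfol, ?_⟩
      · rw [hπ]
        refine expect_congr fun x hx => ?_
        simp only [SemiOnline.gain, SemiOnline.accepted, if_neg (hno x hx)]
      · have h₁ : (2 * L + 300) * (t₁ + (t₂ + N + 1)) ≤ (2 * L + 300) * (t + N + 1) :=
          Nat.mul_le_mul_left _ (by omega)
        have h₂ : L + t₁ + 200 ≤ (2 * L + 300) * t₁ :=
          add_le_step_mul L hr.pos
        rw [mul_add] at h₁
        omega
    · cases hs : (M i).terminal (s i) with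
      | true =>
        -- In a terminal state the surrogate is the index itself, so the answer is yes for every
        -- possible vector, and the accepted chain is indeed terminal.
        have hyes : ∀ x, InSupport (laws I s) x → θ ≤ x i := fun x hx =>
          hθ.trans_eq (eq_idx_of_inSupport hx hs).symm
        obtain ⟨hc, d, t₁, t₂, hr, ht, hf⟩ := follows_probe_common (b := true)
          (fun x hx => decide_eq_true (hyes x hx)) hA
        obtain ⟨m, _⟩ := c
        subst hc
        rw [reaction_yes I hθ hs] at hrd
        obtain ⟨tb, htb, hrb⟩ := simBody_yes (tabs := cellTable I)
          (acc := l.map fun i : Fin n => encNat i) hrd hr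
        obtain ⟨π, hπ, c', u₁, u₂, hrun, hfol, hu'⟩ := ihy N s (i :: l) d t₂ hN (by simp [hl]) hF
          (fun k hk => by
            rcases Finset.mem_insert.1 hk with rfl | hk
            · exact hs
            · exact hT k hk)
          (fun x hx => by simpa using hf x hx)
        refine ⟨π, ?_, c', _, u₂, hrb.loop_again hrun, hfol, ?_⟩
        · rw [hπ]
          refine expect_congr fun x hx => ?_
          simp only [SemiOnline.gain, SemiOnline.accepted, if_pos (hyes x hx)]
        · have h₁ : (2 * L + 300) * (t₁ + (t₂ + N + 1)) ≤ (2 * L + 300) * (t + N + 1) :=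
            Nat.mul_le_mul_left _ (by omega)
          have h₂ : L + t₁ + 200 ≤ (2 * L + 300) * t₁ :=
            add_le_step_mul L hr.pos
          rw [mul_add] at h₁
          omega
      | false =>
        obtain ⟨x, hx⟩ := exists_inSupport (laws I s)
        have hc : c.2 = .inr (encNat i, θ) := (hA x hx).1
        obtain ⟨m, _⟩ := c
        subst hc
        rw [reaction_advance I hθ hs] at hrd
        obtain ⟨tb, htb, hrb⟩ := simBody_advance (B := B) (m := m) (tabs := cellTable I)
          (acc := l.map fun i : Fin n => encNat i) hrd
        -- Policies branch over all states `r`, but only transitions of positive probability are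
        -- controlled; the other branches halt with the empty set. The extra `L + 61` pays for
        -- updating the current cell.
        have hnext : ∀ r, ∃ π : Policy F M (Function.update s i r), 0 < (M i).trans (s i) r →
            π.util = expect (laws I (Function.update s i r))
              (SemiOnline.probe i hi hF θ yes no).gain ∧
            ∃ d t₁ t₂, (simPolicy B pd pu pin).next.Runs
              (((m, .inr (encNat i, θ)), cellTable I, currentCells I s,
                l.map fun i : Fin n => encNat i), encNat r) d t₁ ∧
              t₁ + t₂ ≤ L + 61 + (2 * L + 300) * (t + N) ∧
              π.Follows (simPolicy B pd pu pin) d t₂ := by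
          intro r
          by_cases hr : 0 < (M i).trans (s i) r
          · have hlt := (sum_rank_update_lt (M := M) (s := s) (i := i) (r := r) ⟨hs, hr⟩).trans_le hN
            obtain ⟨π, hπ, d, u₁, u₂, hrun, hfol, hu'⟩ := ihN _ hlt (Function.update s i r) l
              (m, .inr (encNat i, θ)) t le_rfl hl
              (fun k hk => by
                rw [Function.update_of_ne (by rintro rfl; exact hi hk)]
                exact hT k hk)
              (fun x hx => follows_probe_advance hθ hs hr hA hx)
            obtain ⟨tu, htu, hru⟩ := hu s i r θ
            obtain ⟨tn, htn, hrn⟩ := simNext_runs (B := B) (c := (m, .inr (encNat i, θ)))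
              (acc := l.map fun i : Fin n => encNat i) hru
            refine ⟨π, fun _ => ⟨hπ, d, _, u₂, hrn.comp hrun, ?_, hfol⟩⟩
            have h₁ : (2 * L + 300) *
                (t + ∑ k, (M k).rank (Function.update s i r k) + 1) ≤ (2 * L + 300) * (t + N) :=
              Nat.mul_le_mul_left _ (by omega)
            omega
          · exact ⟨.halt ∅ F.empty_mem (by simp), fun h => absurd h hr⟩
        choose next hnext using hnext
        refine ⟨.advance i hs next, ?_, _, _, L + 61 + (2 * L + 300) * (t + N), hrb.loop_done,
          ⟨rfl, fun r hr => (hnext r hr).2⟩, ?_⟩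
        · rw [Policy.util, ← expect_advance_eq I s hs fun x y =>
            SemiOnline.gain_update_sub hθ x y]
          congr 1
          refine Finset.sum_congr rfl fun r _ => ?_
          rcases ((M i).trans_nonneg _ hs r).eq_or_lt with h | h
          · rw [← h, zero_mul, zero_mul]
          · rw [(hnext r h).1]
        · rw [mul_add _ (t + N) 1]
          omega

end Simulation

/-! ## The reduction -/

/-- The distributions of the surrogate values, the cells of all states and the cells of the roots,
from the tables of indices of the chains. -/
noncomputable def simData (x : Ty.chains.Val) :
    (Ty.prod .dists (.prod (.list (.list .cell)) (.list .cell))).Val :=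
  (x.map fun D => ((entryTable D).headD ((0, .inl ()), [])).2,
    x.map fun D => (entryTable D).map fun e => e.1,
    x.map fun D => ((entryTable D).headD ((0, .inl ()), [])).1)

theorem poly_simData : Poly simData := by
  have hT : Poly (a := .prod .chains (.list .state)) (b := .list .entry)
      (fun w => entryTable w.2) := poly_entryTable.comp (.snd .id)
  have hh : Poly (a := .prod .chains (.list .state)) (b := .entry)
      (fun w => (entryTable w.2).headD ((0, .inl ()), [])) :=
    .headD hT (.pair (.pair (.const 0) (.inl .unit)) .nil)
  have hc : Poly (a := .prod .chains (.list .state)) (b := .list .cell)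
      (fun w => (entryTable w.2).map fun e => e.1) :=
    .map (b := .entry) (c := .cell) (f := fun u => u.2.1) (.fst (.snd .id)) hT
  exact .pair (.map hh.snd .id) (.pair (.map hc .id) (.map hh.fst .id))

/-! ### Encodings and sizes of instances -/

section Instance

variable {n : ℕ} (M : Fin n → MarkovChain)

theorem encChains_eq : encChains M = List.ofFn fun i => List.ofFn (M i).encState := rfl

/-- The root is state 0, so its entry is the head of the table, and the table is never empty. The
list of atoms is already in the form of an encoded distribution. -/
theorem simData_encChains : simData (encChains M) =
    (encDists (laws (fun i => (M i).index) (root M)), cellTable (fun i => (M i).index),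
      currentCells (fun i => (M i).index) (root M)) := by
  have hh : ∀ i, (entryTable (List.ofFn (M i).encState)).headD ((0, .inl ()), []) =
      (M i).entry 0 := fun i => by
    rw [MarkovChain.entryTable_eq, List.ofFn_succ]; rfl
  simp only [simData, encChains_eq, List.map_ofFn, Function.comp_def]
  refine Prod.ext (congrArg List.ofFn (funext fun i => ?_))
    (Prod.ext (congrArg List.ofFn (funext fun i => ?_)) (congrArg List.ofFn (funext fun i => ?_)))
  · exact (congrArg Prod.snd (hh i)).trans (FinDist.ofFn_ofList
      (MarkovChain.entry_sorted 0) (MarkovChain.entry_pos 0) (MarkovChain.entry_total 0)).symm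
  · refine (congrArg (List.map fun e => e.1) (M i).entryTable_eq).trans ?_
    rw [List.map_ofFn]
    exact congrArg List.ofFn (funext fun s => Prod.ext rfl ((M i).entry_flag s))
  · exact (congrArg Prod.fst (hh i)).trans (Prod.ext rfl ((M i).entry_flag 0))

theorem sum_size_le : ∑ i, ((M i).m + 1) + n ≤ Ty.chains.size (encChains M) := by
  have h : ∀ i, (M i).m + 1 ≤ (Ty.list .state).size (List.ofFn (M i).encState) := fun i => by
    have := Ty.length_lt_size (a := .state) (List.ofFn (M i).encState)
    rw [List.length_ofFn] at this
    exact this.le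
  have := Finset.sum_le_sum fun i (_ : i ∈ Finset.univ) => h i
  have h' : Ty.chains.size (encChains M) =
      ∑ i, (Ty.list .state).size (List.ofFn (M i).encState) + n + 1 := by
    rw [encChains_eq, Ty.size_list, List.map_ofFn, List.sum_ofFn, List.length_ofFn]
    rfl
  omega

theorem size_encNat (m : ℕ) : Ty.nat.size (encNat m) = 2 * m + 1 := by
  simp [Ty.size, encNat]; omega

theorem size_currentCells (I : ∀ i, ChainIndex (M i)) (s : ∀ i, (M i).State) :
    (Ty.list .cell).size (currentCells I s) = 5 * n + 1 := by
  have : ∀ i, Ty.cell.size (cellOf I i (s i)) = 4 := fun i => by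
    rw [show Ty.cell.size (cellOf I i (s i)) = 1 + Ty.bool.size _ + 1 from rfl, size_bool]
  rw [currentCells, Ty.size_list, List.map_ofFn, List.sum_ofFn, List.length_ofFn]
  simp only [Function.comp_def, this, Finset.sum_const, Finset.card_univ, Fintype.card_fin,
    smul_eq_mul]
  omega

end Instance

/-- Every execution of a semi-online algorithm on the surrogate distributions turns into an
execution of the simulating policy, of the same value and of polynomially related length. -/
theorem exists_policyAlg {a : Ty} (B : SemiOnlineAlg a) :
    ∃ (T : PolicyAlg a) (q L : Polynomial ℕ), ∀ {n : ℕ} (F : Constraint n)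
      (M : Fin n → MarkovChain) (e : a.Val) (A : SemiOnline F ∅) (t Y : ℕ),
      Y = Ty.chains.size (encChains M) →
      B.ExecutesSemiOnline e (laws (fun i => (M i).index) (root M)) A t →
      Ty.dists.size (encDists (laws (fun i => (M i).index) (root M))) ≤ q.eval Y ∧
      ∃ π : Policy F M (root M), π.util = A.value (laws (fun i => (M i).index) (root M)) ∧
        T.ExecutesPolicy e M π
          (q.eval Y + 100 + t + (2 * L.eval Y + 300) * (t + Y + 1)) := by
  obtain ⟨pin, q, hq⟩ := poly_simData
  obtain ⟨pd, qd, hd⟩ := poly_reaction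
  obtain ⟨pu, qu, hu⟩ := poly_moveCells
  -- Both subroutines read data of size at most `q + 20 * X + 20`: the table is part of the output
  -- of `simData`, while the current cells and the unary indices are linear in the input size.
  refine ⟨simPolicy B pd pu pin, q, (qd + qu).comp (q + 20 * .X + 20), ?_⟩
  intro n F M e A t Y hY hB
  subst hY
  set I : ∀ i, ChainIndex (M i) := fun i => (M i).index
  set Y := Ty.chains.size (encChains M)
  obtain ⟨hsize, ti, hti, hri⟩ := hq (encChains M)
  rw [simData_encChains] at hsize hri
  replace hti : ti ≤ q.eval Y := hti
  have hsize' : Ty.dists.size (encDists (laws I (root M))) +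
      ((Ty.list (.list .cell)).size (cellTable I) +
        (Ty.list .cell).size (currentCells I (root M)) + 1) + 1 ≤ q.eval Y := hsize
  refine ⟨by omega, ?_⟩
  obtain ⟨c, t₀, hr₀, hA⟩ := hB
  have hn : ∑ i, ((M i).m + 1) + n ≤ Y := sum_size_le M
  have hm : ∀ i, (M i).m + 1 ≤ Y := fun i =>
    (Finset.single_le_sum (f := fun i => (M i).m + 1) (fun _ _ => Nat.zero_le _)
      (Finset.mem_univ i)).trans (by omega)
  simp only [Polynomial.eval_comp, Polynomial.eval_add, Polynomial.eval_mul, Polynomial.eval_X,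
    Polynomial.eval_ofNat]
  set Z := q.eval Y + 20 * Y + 20
  have ht₀ : t₀ ≤ t := by
    obtain ⟨x, hx⟩ := exists_inSupport (laws I (root M))
    obtain ⟨t₁, -, h⟩ := hA x hx
    omega
  obtain ⟨π, hπ, c', t₁, t₂, hrun, hfol, ht⟩ := exists_policy_simulating (F := F) (I := I) (B := B)
    (pd := pd) (pu := pu) (pin := pin) (L := qd.eval Z + qu.eval Z)
    (fun s i θ => by
      obtain ⟨-, td, htd, hr⟩ := hd ((encNat i, θ), currentCells I s)
      refine ⟨td, htd.trans ((eval_mono qd ?_).trans (Nat.le_add_right _ _)), hr⟩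
      rw [show (Ty.prod (.prod .nat .real) (.list .cell)).size
        ((encNat i, θ), currentCells I s) = Ty.nat.size (encNat i) + 1 + 1 +
          (Ty.list .cell).size (currentCells I s) + 1 from rfl, size_encNat, size_currentCells]
      have := i.2
      omega)
    (fun s i r θ => by
      obtain ⟨-, tu, htu, hr⟩ := hu ((.inr (encNat i, θ), cellTable I, currentCells I s), encNat r)
      replace hr : pu.Runs _ (moveCells (.inr (encNat i, θ)) (cellTable I) (currentCells I s)
        (encNat r)) tu := hr
      rw [moveCells_eq] at hr
      refine ⟨tu, htu.trans ((eval_mono qu ?_).trans (Nat.le_add_left _ _)), hr⟩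
      rw [show (Ty.prod (.prod (.sum .unit (.prod .nat .real))
        (.prod (.list (.list .cell)) (.list .cell))) .nat).size
        ((.inr (encNat i, θ), cellTable I, currentCells I s), encNat r) =
          Ty.nat.size (encNat i) + 1 + 1 + 1 + ((Ty.list (.list .cell)).size (cellTable I) +
          (Ty.list .cell).size (currentCells I s) + 1) + 1 + Ty.nat.size (encNat r) + 1 from rfl,
        size_encNat, size_encNat, size_currentCells]
      have := i.2
      have := r.2
      have := hm i
      omega)
    -- A rank is at most the number of states of its chain, so the input size `Y` bounds the sum of
    -- the ranks at the root. The time `t₀` of `B.start` is accounted for separately.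
    A Y (root M) [] c (t - t₀)
    ((Finset.sum_le_sum fun i _ => (M i).rank_le _).trans
      ((Finset.sum_le_sum fun i _ => Nat.le_add_right _ 1).trans (by omega)))
    rfl F.empty_mem (by simp)
    (fun x hx => by
      obtain ⟨t₁, h, ht⟩ := hA x hx
      exact A.follows_mono (by omega) h)
  obtain ⟨ts, hts, hrs⟩ := simStart_runs (B := B) hri hr₀
  refine ⟨π, hπ, c', _, t₂, hrs.comp hrun, hfol, ?_⟩
  have h₁ : (2 * (qd.eval Z + qu.eval Z) + 300) * (t - t₀ + Y + 1) ≤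
      (2 * (qd.eval Z + qu.eval Z) + 300) * (t + Y + 1) := Nat.mul_le_mul_left _ (by omega)
  omega

end CICS

/-! ### The approximation theorem -/

theorem theorem4p1 {K : Type*} {n : K → ℕ} (F : ∀ k, CICS.Constraint (n k))
    {a : CICS.Ty} (enc : K → a.Val) (α : K → ℝ) (B : CICS.SemiOnlineAlg a)
    (hB : B.EfficientSemiOnline F enc) (hα : B.ApproximatesExPost F enc α) :
    ∃ T : CICS.PolicyAlg a, T.EfficientPolicy F enc ∧ T.ApproximatesOpt F enc α := by
  obtain ⟨T, q, L, hT⟩ := CICS.exists_policyAlg B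
  refine ⟨T, ?_, fun k M => ?_⟩
  · obtain ⟨p, hp⟩ := hB
    -- `B` runs on the encoded constraint and the surrogate distributions, an input of size at most
    -- `X + q + 1`.
    refine ⟨q + 100 + p.comp (.X + q + 1) + (2 * L + 300) * (p.comp (.X + q + 1) + .X + 1),
      fun k M => ?_⟩
    obtain ⟨A, hA⟩ := hp k (CICS.laws (fun i => (M i).index) (CICS.root M))
    obtain ⟨hs, π, -, c, t₀, t₁, h₀, h₁, ht⟩ := hT (F k) M (enc k) A _ _ rfl hA
    refine ⟨π, c, t₀, t₁, h₀, h₁, ht.trans ?_⟩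
    simp only [Polynomial.eval_comp, Polynomial.eval_add, Polynomial.eval_mul, Polynomial.eval_X,
      Polynomial.eval_ofNat, Polynomial.eval_one]
    have hX : (CICS.Ty.prod a CICS.Ty.chains).size (enc k, CICS.encChains M) =
      a.size (enc k) + CICS.Ty.chains.size (CICS.encChains M) + 1 := rfl
    have hD : (CICS.Ty.prod a CICS.Ty.dists).size
        (enc k, CICS.encDists (CICS.laws (fun i => (M i).index) (CICS.root M))) =
      a.size (enc k) +
        CICS.Ty.dists.size (CICS.encDists (CICS.laws (fun i => (M i).index) (CICS.root M))) + 1 :=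
      rfl
    rw [hX, hD]
    have hY : CICS.Ty.chains.size (CICS.encChains M) ≤
      a.size (enc k) + CICS.Ty.chains.size (CICS.encChains M) + 1 := by omega
    have hq := CICS.eval_mono q hY
    have hL := CICS.eval_mono L hY
    have hp' := CICS.eval_mono p (show a.size (enc k) +
        CICS.Ty.dists.size (CICS.encDists (CICS.laws (fun i => (M i).index) (CICS.root M))) + 1 ≤
      a.size (enc k) + CICS.Ty.chains.size (CICS.encChains M) + 1 +
        q.eval (a.size (enc k) + CICS.Ty.chains.size (CICS.encChains M) + 1) + 1 by omega)
    gcongr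
  -- This procedure need not be the one used for the running time; the program `T` depends on `B`
  -- only and so serves both purposes.
  · obtain ⟨A, t, hA, hle⟩ := hα k (CICS.laws (fun i => (M i).index) (CICS.root M))
    obtain ⟨-, π, hπ, hrun⟩ := hT (F k) M (enc k) A t _ rfl hA
    have : Nonempty (CICS.Policy (F k) M (CICS.root M)) := ⟨π⟩
    -- The optimum is at most the ex post optimum of the surrogates, which is at most `α k` times
    -- the value of `A`, and this value is the utility of `π`.
    exact ⟨π, _, hrun, (ciSup_le fun π' => CICS.util_le_expect π').trans (hπ ▸ hle)⟩
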